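/- **Conventions.** A line arrangement $\mathcal B: g=0$ in $\mathbb P^2$ (or hyperplane arrangement in $\mathbb P^{n}$) is given by a reduced equation $g$, i.e. a nonzero constant times a product of pairwise non-proportional nonzero linear forms with complex coefficients. Its intersection lattice $L(\mathcal B)$ is the set of all intersections of families of hyperplanes of the corresponding central arrangement in $\mathbb C^{n+1}$ (the empty family giving $\mathbb C^{n+1}$), ordered by reverse inclusion. For a homogeneous polynomial $f\in S=\mathbb C[x_0,\dots,x_n]$, let $J_f$ be the ideal generated by all first partial derivatives of $f$ and let $M(f)=S/J_f$ be the graded Jacobian algebra. Its Hilbert function is $k\mapsto\dim_{\mathbb C} M(f)_k$, and its Hilbert polynomial $P(M(f))\in\mathbb Q[u]$ is the unique polynomial with $P(M(f))(k)=\dim M(f)_k$ for all sufficiently large $k$. The graded Betti numbers of $M(f)$ are the numbers of summands $S(-j)$ in each step $i$ of a minimal graded free resolution of $M(f)$ over $S$. Let $\mathcal A:f=0$ and $\mathcal A':f'=0$ be hyperplane arrangements in the same $\mathbb P^n$. - $(\mathcal A,\mathcal A')$ is a *Ziegler pair* if $L(\mathcal A)\cong L(\mathcal A')$ but $M(f)$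 and $M(f')$ have distinct graded Betti numbers. - (HF) holds if $\dim M(f)_k=\dim M(f')_k$ for all $k$. - (SPEC) holds if there are $t_0>0$ and a smooth family $f_t$, $t\in[0,t_0]$, of homogeneous polynomials that are reduced equations of hyperplane arrangements $\mathcal A_t:f_t=0$, with $f_0=f$ and $f_{t_0}=f'$, such that $L(\mathcal A_s)\cong L(\mathcal A_t)$ for all $s,t\in[0,t_0]$ and the graded Betti numbers of $M(f_t)$ are constant for $0<t\le t_0$. **Theorem 1.3.** Let $\mathcal B:g=0$ and $\mathcal B':g'=0$ be line arrangements in $\mathbb P^2$, where $g,g'\in\mathbb C[x,y,z]$, and let $f=wg$ and $f'=wg'$ in $\mathbb C[x,y,z,w]$ be the equations of their cones in $\mathbb P^3$. 1. If $\mathcal B$ and $\mathcal B'$ have isomorphic intersection lattices, then so do the cones $\mathcal A:f=0$ and $\mathcal A':f'=0$. 2. If $(\mathcal B,\mathcal B')$ is a Ziegler pair that satisfies (SPEC) and does not satisfy (HF), then the Hilbert polynomials of $M(f)$ and $M(f')$ are different, $P(M(f))\neq P(M(f'))$; more precisely, $P(M(f))(0)>P(M(f'))(0)$. -/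

import Mathlib

open MvPolynomial
open scoped ContDiff

/-! ### Hyperplane arrangements given by an equation

An arrangement `g = 0` in `ℙⁿ⁻¹` is given by its reduced equation `g` in `n` variables, and is
treated as a central arrangement in `ℂⁿ`. -/

/-- `g` is a nonzero constant times a product of nonzero, pairwise non-proportional linear forms. -/
def IsArrangementEquation {n : ℕ} (g : MvPolynomial (Fin n) ℂ) : Prop :=
  ∃ (e : ℕ) (ℓ : Fin e → MvPolynomial (Fin n) ℂ) (c : ℂ),
    c ≠ 0 ∧ (∀ i, (ℓ i).IsHomogeneous 1 ∧ ℓ i ≠ 0) ∧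
    (∀ i j, i ≠ j → ∀ a : ℂ, ℓ i ≠ a • ℓ j) ∧
    g = C c * ∏ i, ℓ i

/-- The hyperplanes of the arrangement `g = 0`: the codimension one linear subspaces of `ℂⁿ`
contained in the zero set of `g`. -/
def arrangementHyperplanes {n : ℕ} (g : MvPolynomial (Fin n) ℂ) :
    Set (Submodule ℂ (Fin n → ℂ)) :=
  {H | IsCoatom H ∧ ∀ v ∈ H, eval v g = 0}

/-- The intersections of families of hyperplanes of `g = 0`; the empty family gives `ℂⁿ`. -/
def arrangementFlats {n : ℕ} (g : MvPolynomial (Fin n) ℂ) : Set (Submodule ℂ (Fin n → ℂ)) :=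
  {X | ∃ s ⊆ arrangementHyperplanes g, X = sInf s}

/-- The intersection lattice `L(𝒜)` of `𝒜 : g = 0`, ordered by reverse inclusion. -/
abbrev IntersectionLattice {n : ℕ} (g : MvPolynomial (Fin n) ℂ) : Type :=
  (↥(arrangementFlats g))ᵒᵈ

/-- The arrangements `g = 0` and `g' = 0` have isomorphic intersection lattices. -/
def SameLattice {n : ℕ} (g g' : MvPolynomial (Fin n) ℂ) : Prop :=
  Nonempty (IntersectionLattice g ≃o IntersectionLattice g')

/-- The equation `w g` of the cone over `g = 0`, where `w` is a new (last) variable. -/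
noncomputable def coneEquation {n : ℕ} (g : MvPolynomial (Fin n) ℂ) :
    MvPolynomial (Fin (n + 1)) ℂ :=
  X (Fin.last n) * rename Fin.castSucc g

/-! ### The Jacobian algebra and its Hilbert function and polynomial -/

/-- The Jacobian ideal `J_f`, spanned by the partial derivatives of `f`. -/
noncomputable def jacobianIdeal {n : ℕ} (f : MvPolynomial (Fin n) ℂ) :
    Ideal (MvPolynomial (Fin n) ℂ) :=
  Ideal.span (Set.range fun i => pderiv i f)

/-- The Jacobian algebra `M(f) = S / J_f`. -/
abbrev JacobianAlgebra {n : ℕ} (f : MvPolynomial (Fin n) ℂ) : Type :=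
  MvPolynomial (Fin n) ℂ ⧸ jacobianIdeal f

/-- The graded piece `M(f)_k`: the classes of the homogeneous polynomials of degree `k`. -/
noncomputable def jacobianPiece {n : ℕ} (f : MvPolynomial (Fin n) ℂ) (k : ℕ) :
    Submodule ℂ (JacobianAlgebra f) :=
  (homogeneousSubmodule (Fin n) ℂ k).map (Ideal.Quotient.mkₐ ℂ (jacobianIdeal f)).toLinearMap

/-- The Hilbert function `H(M(f))(k) = dim M(f)_k` (it vanishes in negative degrees). -/
noncomputable def jacobianHilbertFunction {n : ℕ} (f : MvPolynomial (Fin n) ℂ) (k : ℕ) : ℕ :=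
  Module.finrank ℂ (jacobianPiece f k)

/-- `P` is the (necessarily unique) Hilbert polynomial `P(M(f))`. -/
def IsJacobianHilbertPolynomial {n : ℕ} (f : MvPolynomial (Fin n) ℂ) (P : Polynomial ℚ) : Prop :=
  ∃ k₀ : ℕ, ∀ k : ℕ, k₀ ≤ k → (jacobianHilbertFunction f k : ℚ) = P.eval (k : ℚ)

/-! ### Graded Betti numbers -/

/-- A minimal graded free resolution `⋯ → F₂ → F₁ → F₀ → S/J → 0` of `S/J`, where
`S = ℂ[x₁, …, xₙ]`, with `F i = ⨁ₖ S(-shift i k)` of finite rank and all maps homogeneous of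
degree zero. -/
structure MinimalGradedFreeResolution {n : ℕ} (J : Ideal (MvPolynomial (Fin n) ℂ)) where
  /-- The rank of `F i`. -/
  rank : ℕ → ℕ
  /-- The degrees of the basis elements of `F i`. -/
  shift : ∀ i, Fin (rank i) → ℕ
  /-- The augmentation `F 0 → S/J`. -/
  aug : (Fin (rank 0) → MvPolynomial (Fin n) ℂ) →ₗ[MvPolynomial (Fin n) ℂ]
    (MvPolynomial (Fin n) ℂ ⧸ J)
  /-- The differential `F (i + 1) → F i`. -/
  d : ∀ i, (Fin (rank (i + 1)) → MvPolynomial (Fin n) ℂ) →ₗ[MvPolynomial (Fin n) ℂ]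
    (Fin (rank i) → MvPolynomial (Fin n) ℂ)
  aug_graded : ∀ k, ∃ p : MvPolynomial (Fin n) ℂ,
    p.IsHomogeneous (shift 0 k) ∧ aug (Pi.single k 1) = Ideal.Quotient.mk J p
  d_graded : ∀ i l k, d i (Pi.single l 1) k ≠ 0 →
    ∃ m : ℕ, shift i k + m = shift (i + 1) l ∧ (d i (Pi.single l 1) k).IsHomogeneous m
  aug_surjective : Function.Surjective aug
  exact_aug : Function.Exact (d 0) aug
  exact_d : ∀ i, Function.Exact (d (i + 1)) (d i)
  /-- Minimality: the image of each differential lies in `𝔪 F i`, with `𝔪 = (x₁, …, xₙ)`. -/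
  minimal : ∀ i v k, constantCoeff (d i v k) = 0

/-- The graded Betti number `β_{i,j}`: the number of summands `S(-j)` in `F i`. -/
def MinimalGradedFreeResolution.betti {n : ℕ} {J : Ideal (MvPolynomial (Fin n) ℂ)}
    (F : MinimalGradedFreeResolution J) (i j : ℕ) : ℕ :=
  (Finset.univ.filter fun k => F.shift i k = j).card

/-- `β` is the family of graded Betti numbers of the Jacobian algebra `M(f)`. -/
def IsJacobianBetti {n : ℕ} (f : MvPolynomial (Fin n) ℂ) (β : ℕ → ℕ → ℕ) : Prop :=
  ∃ F : MinimalGradedFreeResolution (jacobianIdeal f), F.betti = β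

/-! ### Ziegler pairs -/

/-- `f = 0` and `f' = 0` form a Ziegler pair: the intersection lattices are isomorphic, and the
graded Betti numbers of `M(f)` and `M(f')` are distinct. -/
def IsZieglerPair {n : ℕ} (f f' : MvPolynomial (Fin n) ℂ) : Prop :=
  IsArrangementEquation f ∧ IsArrangementEquation f' ∧ SameLattice f f' ∧
    ¬ ∃ β, IsJacobianBetti f β ∧ IsJacobianBetti f' β

/-- Condition (HF): the Hilbert functions of `M(f)` and `M(f')` coincide. -/
def ConditionHF {n : ℕ} (f f' : MvPolynomial (Fin n) ℂ) : Prop :=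
  ∀ k, jacobianHilbertFunction f k = jacobianHilbertFunction f' k

/-- Condition (SPEC): there is a smooth family `F t`, `t ∈ [0, t₀]`, of equations of arrangements
with constant intersection lattice, from `F 0 = f` to `F t₀ = f'`, such that the graded Betti
numbers of `M(F t)` are constant for `0 < t ≤ t₀`. -/
def ConditionSPEC {n : ℕ} (f f' : MvPolynomial (Fin n) ℂ) : Prop :=
  ∃ (t₀ : ℝ) (F : ℝ → MvPolynomial (Fin n) ℂ), 0 < t₀ ∧
    (∀ m, ContDiffOn ℝ ∞ (fun t => coeff m (F t)) (Set.Icc 0 t₀)) ∧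
    F 0 = f ∧ F t₀ = f' ∧
    (∀ t ∈ Set.Icc 0 t₀, IsArrangementEquation (F t)) ∧
    (∀ s ∈ Set.Icc 0 t₀, ∀ t ∈ Set.Icc 0 t₀, SameLattice (F s) (F t)) ∧
    ∃ β, ∀ t ∈ Set.Ioc 0 t₀, IsJacobianBetti (F t) β

/-!
# Hilbert polynomials of cones over Ziegler pairs of line arrangements

Write `S` for the polynomial ring, `J_g` for the Jacobian ideal of `g` and `h_g` for the Hilbert
function of `M(g) = S / J_g`.

The hyperplanes of the cone `w g = 0` are `w = 0` and the hyperplanes `H × ℂ`, so its intersection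
lattice is the product of that of `g = 0` with a chain of two elements; hence the lattice of the
arrangement determines that of the cone
(`IsArrangementEquation.exists_orderIso_coneEquation`).

For the Hilbert polynomials, note that `J_{wg}` is generated by `g` and by `w J_g`. As `g ∈ J_g` by
Euler's identity, expanding in powers of `w` gives
`dim M(wg)_k = dim (S / (g))_k + ∑_{j < k} h_g(j)` (`hilbertFunction_coneEquation`).
The first term depends only on the number of lines. For a line arrangement `h_g(k)` is
`τ = ∑ (m_p - 1) ^ 2` for large `k`, with one term for each multiple point `p`, lying on `m_p` lines
(`IsReducedFamily.exists_hilbertFunction_eq_tjurinaNumber`). The number of lines and `τ` are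
determined by the lattice (`exists_equiv_of_sameLattice`, `tjurinaNumber_eq_of_equiv`), so the two
Hilbert polynomials differ by the constant `∑_j (h_g(j) - h_{g'}(j))`. All terms of this sum are
nonnegative: Betti numbers determine the Hilbert function
(`hilbertFunction_eq_of_isJacobianBetti`), so `h_{g'}` is the Hilbert function of every member
`f_t`, `t > 0`, of the family, and Hilbert functions can only go up in the limit `t → 0`, because
linear independence is an open condition (`exists_hilbertFunction_le`). If (HF) fails, some term is
positive.

The formula for `τ` is proved without localization. For a multiple point `p` let `g_p` be the
product of the lines through `p` and `e_p` the product of the others. The product rule gives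
`J_g ⊆ J_{g_p}` and `e_p ^ 2 J_{g_p} ⊆ J_g`. By the Nullstellensatz every form of large degree is a
combination of the `e_p ^ 2`, so that `M(g)_k` is a sum of images of the algebras `M(g_p)`. For a
suitable `N` it is also congruent modulo `J_{g_p}` to a multiple of `e_p ^ N`, for each `p`, while
`e_p ^ N ∈ J_{g_q}` for `q ≠ p`, so that `M(g)_k` maps onto the product of the `M(g_p)_k`. Both bounds equal `τ`, because `J_{g_p}` is a
complete intersection of two forms of degree `m_p - 1` (`IsPoint.hilbertFunction_eq`).
-/

/-! ### Graded pieces of polynomial rings and of their quotients -/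

/-- The exponents of the monomials of degree `k` in `n` variables. -/
abbrev Exponents (n k : ℕ) : Type := {m // m ∈ (Finset.univ : Finset (Fin n)).finsuppAntidiag k}

theorem mem_finsuppAntidiag_univ_iff {n k : ℕ} {m : Fin n →₀ ℕ} :
    m ∈ (Finset.univ : Finset (Fin n)).finsuppAntidiag k ↔ m.degree = k := by
  simp [Finset.mem_finsuppAntidiag, Finsupp.degree_eq_sum]

/-- The coefficients of the monomials of degree `k`. -/
noncomputable def coeffVector (n k : ℕ) :
    MvPolynomial (Fin n) ℂ →ₗ[ℂ] (Exponents n k → ℂ) where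
  toFun p m := coeff m.1 p
  map_add' p q := by ext m; simp
  map_smul' c p := by ext m; simp

theorem eq_zero_of_coeffVector_eq_zero {n k : ℕ} {p : MvPolynomial (Fin n) ℂ}
    (hp : p.IsHomogeneous k) (h : coeffVector n k p = 0) : p = 0 := by
  ext m
  by_cases hm : m.degree = k
  · exact congrFun h ⟨m, mem_finsuppAntidiag_univ_iff.2 hm⟩
  · simpa using hp.coeff_eq_zero hm

theorem sum_monomial_coeff_of_isHomogeneous {n k : ℕ} {p : MvPolynomial (Fin n) ℂ}
    (hp : p.IsHomogeneous k) :
    p = ∑ m : Exponents n k, coeff m.1 p • monomial m.1 (1 : ℂ) := by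
  classical
  have hmon : ∀ m : Exponents n k, (monomial m.1 (1 : ℂ)).IsHomogeneous k := fun m =>
    isHomogeneous_monomial _ (mem_finsuppAntidiag_univ_iff.1 m.2)
  rw [← sub_eq_zero]
  refine eq_zero_of_coeffVector_eq_zero (k := k) (hp.sub (IsHomogeneous.sum _ _ _ fun m _ => ?_)) ?_
  · exact (homogeneousSubmodule (Fin n) ℂ k).smul_mem _ (hmon m)
  · ext m
    simp [coeffVector, coeff_sum, coeff_monomial]

/-- Forms of degree `k` are the same as vectors of coefficients. -/
noncomputable def homogeneousEquiv (n k : ℕ) :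
    homogeneousSubmodule (Fin n) ℂ k ≃ₗ[ℂ] (Exponents n k → ℂ) :=
  LinearEquiv.ofBijective ((coeffVector n k).domRestrict _) <| by
    classical
    constructor
    · rw [← LinearMap.ker_eq_bot, LinearMap.ker_eq_bot']
      exact fun p hp => Subtype.ext (eq_zero_of_coeffVector_eq_zero p.2 hp)
    · intro c
      refine ⟨⟨∑ m : Exponents n k, c m • monomial m.1 (1 : ℂ), Submodule.sum_mem _ fun m _ =>
        Submodule.smul_mem _ _ (isHomogeneous_monomial _ (mem_finsuppAntidiag_univ_iff.1 m.2))⟩, ?_⟩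
      ext m
      simp [coeffVector, coeff_monomial]

instance finiteDimensional_homogeneousSubmodule (n k : ℕ) :
    Module.Finite ℂ (homogeneousSubmodule (Fin n) ℂ k) :=
  Module.Finite.equiv (homogeneousEquiv n k).symm

theorem finrank_homogeneousSubmodule (n k : ℕ) :
    Module.finrank ℂ (homogeneousSubmodule (Fin n) ℂ k) = (n + k - 1).choose k := by
  rw [(homogeneousEquiv n k).finrank_eq, Module.finrank_fintype_fun_eq_card, Fintype.card_coe,
    Finset.card_finsuppAntidiag_nat_eq_choose, Finset.card_fin]

theorem homogeneousComponent_mul_of_le {n i k : ℕ} (a : MvPolynomial (Fin n) ℂ)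
    {b : MvPolynomial (Fin n) ℂ} (hb : b.IsHomogeneous i) (h : i ≤ k) :
    homogeneousComponent k (a * b) = homogeneousComponent (k - i) a * b := by
  let := MvPolynomial.gradedAlgebra (σ := Fin n) (R := ℂ)
  have := DirectSum.coe_decompose_mul_of_right_mem_of_le (homogeneousSubmodule (Fin n) ℂ)
    (a := a) ((mem_homogeneousSubmodule _ _).2 hb) h
  change ((decomposition.decompose' (a * b) k : homogeneousSubmodule (Fin n) ℂ _) :
    MvPolynomial (Fin n) ℂ) = _ at this
  rw [decomposition.decompose'_apply] at this
  rw [this]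
  exact congrArg (· * b) (decomposition.decompose'_apply a (k - i))

theorem homogeneousComponent_mul_of_not_le {n i k : ℕ} (a : MvPolynomial (Fin n) ℂ)
    {b : MvPolynomial (Fin n) ℂ} (hb : b.IsHomogeneous i) (h : ¬ i ≤ k) :
    homogeneousComponent k (a * b) = 0 := by
  let := MvPolynomial.gradedAlgebra (σ := Fin n) (R := ℂ)
  have := DirectSum.coe_decompose_mul_of_right_mem_of_not_le (homogeneousSubmodule (Fin n) ℂ)
    (a := a) ((mem_homogeneousSubmodule _ _).2 hb) h
  change ((decomposition.decompose' (a * b) k : homogeneousSubmodule (Fin n) ℂ _) :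
    MvPolynomial (Fin n) ℂ) = _ at this
  rw [decomposition.decompose'_apply] at this
  rw [this]

/-- A form in an ideal with homogeneous generators is a combination of the generators with
homogeneous coefficients. -/
theorem exists_isHomogeneous_of_mem_span {n k : ℕ} {ι : Type*} [Fintype ι]
    {h : ι → MvPolynomial (Fin n) ℂ} {e : ι → ℕ} (hh : ∀ i, (h i).IsHomogeneous (e i))
    {p : MvPolynomial (Fin n) ℂ} (hp : p.IsHomogeneous k) (hmem : p ∈ Ideal.span (Set.range h)) :
    ∃ a : ι → MvPolynomial (Fin n) ℂ, (∀ i, (a i).IsHomogeneous (k - e i)) ∧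
      (∀ i, ¬ e i ≤ k → a i = 0) ∧ p = ∑ i, a i * h i := by
  obtain ⟨c, hc⟩ := (Ideal.mem_span_range_iff_exists_fun).1 hmem
  refine ⟨fun i => if e i ≤ k then homogeneousComponent (k - e i) (c i) else 0, fun i => ?_,
    fun i hi => if_neg hi, ?_⟩
  · dsimp only
    split_ifs
    · exact homogeneousComponent_isHomogeneous _ _
    · exact isHomogeneous_zero _ _ _
  · rw [← homogeneousComponent_eq_self (mem_homogeneousSubmodule _ _ |>.2 hp), ← hc, map_sum]
    refine Finset.sum_congr rfl fun i _ => ?_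
    dsimp only
    split_ifs with hi
    · exact homogeneousComponent_mul_of_le _ (hh i) hi
    · rw [homogeneousComponent_mul_of_not_le _ (hh i) hi, zero_mul]

/-- The Hilbert function of `S / I`: the dimension of the space of classes of forms of
degree `k`. -/
noncomputable def hilbertFunction {n : ℕ} (I : Ideal (MvPolynomial (Fin n) ℂ)) (k : ℕ) : ℕ :=
  Module.finrank ℂ
    ((homogeneousSubmodule (Fin n) ℂ k).map (Ideal.Quotient.mkₐ ℂ I).toLinearMap)

theorem finrank_map_add_finrank_inf_ker {V W : Type*} [AddCommGroup V] [Module ℂ V]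
    [AddCommGroup W] [Module ℂ W] (U : Submodule ℂ V) [Module.Finite ℂ U] (L : V →ₗ[ℂ] W) :
    Module.finrank ℂ (U.map L) + Module.finrank ℂ (U ⊓ L.ker : Submodule ℂ V) =
      Module.finrank ℂ U := by
  rw [← LinearMap.finrank_range_add_finrank_ker (L.domRestrict U), LinearMap.range_domRestrict,
    LinearMap.ker_domRestrict,
    ← (Submodule.comapSubtypeEquivOfLe (inf_le_left : U ⊓ L.ker ≤ U)).finrank_eq,
    Submodule.comap_inf, Submodule.comap_subtype_self, top_inf_eq]

/-- The forms of degree `k` in `I`. -/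
noncomputable def idealPiece {n : ℕ} (I : Ideal (MvPolynomial (Fin n) ℂ)) (k : ℕ) :
    Submodule ℂ (MvPolynomial (Fin n) ℂ) :=
  homogeneousSubmodule (Fin n) ℂ k ⊓ I.restrictScalars ℂ

theorem mem_idealPiece {n k : ℕ} {I : Ideal (MvPolynomial (Fin n) ℂ)}
    {p : MvPolynomial (Fin n) ℂ} : p ∈ idealPiece I k ↔ p.IsHomogeneous k ∧ p ∈ I :=
  Iff.rfl

instance finiteDimensional_idealPiece {n k : ℕ} (I : Ideal (MvPolynomial (Fin n) ℂ)) :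
    Module.Finite ℂ (idealPiece I k) :=
  Submodule.finiteDimensional_inf_left _ _

theorem hilbertFunction_add_finrank_idealPiece {n : ℕ} (I : Ideal (MvPolynomial (Fin n) ℂ))
    (k : ℕ) : hilbertFunction I k + Module.finrank ℂ (idealPiece I k) =
      Module.finrank ℂ (homogeneousSubmodule (Fin n) ℂ k) := by
  have : idealPiece I k = homogeneousSubmodule (Fin n) ℂ k ⊓
      (Ideal.Quotient.mkₐ ℂ I).toLinearMap.ker := by
    ext p
    simp [mem_idealPiece, Ideal.Quotient.eq_zero_iff_mem]
  rw [this, hilbertFunction, finrank_map_add_finrank_inf_ker]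

/-- If the linear map `L` kills the forms of degree `k` in `I`, then the image of the forms of
degree `k` has dimension at most `dim (S / I)_k`. -/
theorem finrank_map_le_hilbertFunction {n k : ℕ} {I : Ideal (MvPolynomial (Fin n) ℂ)}
    {W : Type*} [AddCommGroup W] [Module ℂ W] (L : MvPolynomial (Fin n) ℂ →ₗ[ℂ] W)
    (h : ∀ p, p.IsHomogeneous k → p ∈ I → L p = 0) :
    Module.finrank ℂ ((homogeneousSubmodule (Fin n) ℂ k).map L) ≤ hilbertFunction I k := by
  have h1 := hilbertFunction_add_finrank_idealPiece I k
  have h2 := finrank_map_add_finrank_inf_ker (homogeneousSubmodule (Fin n) ℂ k) L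
  have : Module.Finite ℂ (homogeneousSubmodule (Fin n) ℂ k ⊓ L.ker : Submodule ℂ _) :=
    Submodule.finiteDimensional_inf_left _ _
  have h3 : Module.finrank ℂ (idealPiece I k) ≤
      Module.finrank ℂ (homogeneousSubmodule (Fin n) ℂ k ⊓ L.ker : Submodule ℂ _) :=
    Submodule.finrank_mono fun p hp => ⟨hp.1, h p hp.1 hp.2⟩
  omega

theorem finrank_map_eq_hilbertFunction {n k : ℕ} {I : Ideal (MvPolynomial (Fin n) ℂ)}
    {W : Type*} [AddCommGroup W] [Module ℂ W] (L : MvPolynomial (Fin n) ℂ →ₗ[ℂ] W)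
    (h : ∀ p, p.IsHomogeneous k → (L p = 0 ↔ p ∈ I)) :
    Module.finrank ℂ ((homogeneousSubmodule (Fin n) ℂ k).map L) = hilbertFunction I k := by
  have h1 := hilbertFunction_add_finrank_idealPiece I k
  have h2 := finrank_map_add_finrank_inf_ker (homogeneousSubmodule (Fin n) ℂ k) L
  have h3 : idealPiece I k = homogeneousSubmodule (Fin n) ℂ k ⊓ L.ker := by
    ext p
    constructor
    · exact fun hp => ⟨hp.1, (h p hp.1).2 hp.2⟩
    · exact fun hp => ⟨hp.1, (h p hp.1).1 hp.2⟩
  rw [h3] at h1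
  omega

/-- A product of submodules, as a submodule of the product and as a product of modules. -/
def submodulePiEquiv {ι : Type*} {V : ι → Type*} [∀ i, AddCommGroup (V i)]
    [∀ i, Module ℂ (V i)] (W : ∀ i, Submodule ℂ (V i)) :
    Submodule.pi Set.univ W ≃ₗ[ℂ] ∀ i, W i where
  toFun w i := ⟨w.1 i, w.2 i (Set.mem_univ i)⟩
  invFun w := ⟨fun i => w i, fun i _ => (w i).2⟩
  map_add' _ _ := rfl
  map_smul' _ _ := rfl

theorem finrank_submodule_pi {ι : Type*} [Fintype ι] {V : ι → Type*} [∀ i, AddCommGroup (V i)]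
    [∀ i, Module ℂ (V i)] (W : ∀ i, Submodule ℂ (V i)) [∀ i, Module.Finite ℂ (W i)] :
    Module.finrank ℂ (Submodule.pi Set.univ W) = ∑ i, Module.finrank ℂ (W i) := by
  rw [(submodulePiEquiv W).finrank_eq, Module.finrank_pi_fintype]

/-! ### Families of linear forms -/

/-- The forms `ℓ i` are nonzero, linear and pairwise non-proportional. -/
def IsReducedFamily {n : ℕ} {ι : Type*} (ℓ : ι → MvPolynomial (Fin n) ℂ) : Prop :=
  (∀ i, (ℓ i).IsHomogeneous 1 ∧ ℓ i ≠ 0) ∧ ∀ i j, i ≠ j → ∀ a : ℂ, ℓ i ≠ a • ℓ j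

/-- The linear functional on `ℂⁿ` given by the linear part of a polynomial. -/
noncomputable def linearFunctional {n : ℕ} :
    MvPolynomial (Fin n) ℂ →ₗ[ℂ] Module.Dual ℂ (Fin n → ℂ) where
  toFun p := ∑ i, constantCoeff (pderiv i p) • LinearMap.proj i
  map_add' p q := by simp [add_smul, Finset.sum_add_distrib]
  map_smul' c p := by simp [Finset.smul_sum, mul_smul]

theorem MvPolynomial.IsHomogeneous.eq_C_constantCoeff {n : ℕ} {p : MvPolynomial (Fin n) ℂ}
    (hp : p.IsHomogeneous 0) : p = C (constantCoeff p) := by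
  have := homogeneousComponent_zero p
  rwa [homogeneousComponent_eq_self hp] at this

theorem pderiv_linear {n : ℕ} {p : MvPolynomial (Fin n) ℂ} (hp : p.IsHomogeneous 1) (i : Fin n) :
    pderiv i p = C (constantCoeff (pderiv i p)) :=
  IsHomogeneous.eq_C_constantCoeff hp.pderiv

theorem linear_eq_sum {n : ℕ} {p : MvPolynomial (Fin n) ℂ} (hp : p.IsHomogeneous 1) :
    p = ∑ i, X i * C (constantCoeff (pderiv i p)) := by
  have := hp.sum_X_mul_pderiv
  rw [one_smul] at this
  conv_lhs => rw [← this]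
  exact Finset.sum_congr rfl fun i _ => congrArg (X i * ·) (pderiv_linear hp i)

theorem eval_eq_linearFunctional {n : ℕ} {p : MvPolynomial (Fin n) ℂ} (hp : p.IsHomogeneous 1)
    (v : Fin n → ℂ) : eval v p = linearFunctional p v := by
  conv_lhs => rw [linear_eq_sum hp]
  simp [linearFunctional, mul_comm]

theorem linearFunctional_eq_zero {n : ℕ} {p : MvPolynomial (Fin n) ℂ} (hp : p.IsHomogeneous 1)
    (h : linearFunctional p = 0) : p = 0 := by
  refine MvPolynomial.funext fun v => ?_
  rw [eval_eq_linearFunctional hp, h]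
  simp

theorem exists_pderiv_ne_zero {n : ℕ} {p : MvPolynomial (Fin n) ℂ} (hp : p.IsHomogeneous 1)
    (h0 : p ≠ 0) : ∃ i, constantCoeff (pderiv i p) ≠ 0 := by
  by_contra! h
  exact h0 (by rw [linear_eq_sum hp]; simp [h])

theorem irreducible_of_linear {n : ℕ} {p : MvPolynomial (Fin n) ℂ} (hp : p.IsHomogeneous 1)
    (h0 : p ≠ 0) : Irreducible p := by
  refine irreducible_of_totalDegree_eq_one (hp.totalDegree h0) fun x hx => ?_
  obtain ⟨m, hm⟩ := ne_zero_iff.1 h0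
  exact (ne_zero_of_dvd_ne_zero hm (hx m)).isUnit

theorem IsReducedFamily.not_dvd {n : ℕ} {ι : Type*} {ℓ : ι → MvPolynomial (Fin n) ℂ}
    (h : IsReducedFamily ℓ) {i j : ι} (hij : i ≠ j) : ¬ ℓ i ∣ ℓ j := by
  intro hd
  obtain ⟨u, hu⟩ := (irreducible_of_linear (h.1 i).1 (h.1 i).2).associated_of_dvd
    (irreducible_of_linear (h.1 j).1 (h.1 j).2) hd
  obtain ⟨c, -, hc⟩ := MvPolynomial.isUnit_iff_eq_C_of_isReduced.1 u.isUnit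
  rw [hc] at hu
  exact h.2 j i hij.symm c (by rw [smul_eq_C_mul, mul_comm, hu])

/-- Two non-proportional linear forms in three variables vanish together exactly on a line. -/
theorem IsReducedFamily.exists_spanning_vector {ι : Type*} {ℓ : ι → MvPolynomial (Fin 3) ℂ}
    (h : IsReducedFamily ℓ) {i j : ι} (hij : i ≠ j) :
    ∃ v : Fin 3 → ℂ, v ≠ 0 ∧
      ∀ u, (eval u (ℓ i) = 0 ∧ eval u (ℓ j) = 0) ↔ ∃ c : ℂ, u = c • v := by
  set W : Submodule ℂ (Module.Dual ℂ (Fin 3 → ℂ)) :=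
    Submodule.span ℂ (Set.range ![linearFunctional (ℓ i), linearFunctional (ℓ j)]) with hW
  have hli : LinearIndependent ℂ ![linearFunctional (ℓ i), linearFunctional (ℓ j)] := by
    rw [LinearIndependent.pair_iff' (fun h0 => (h.1 i).2 (linearFunctional_eq_zero (h.1 i).1 h0))]
    intro a ha
    have h1 : (ℓ j - a • ℓ i).IsHomogeneous 1 :=
      (h.1 j).1.sub ((homogeneousSubmodule _ _ 1).smul_mem a (h.1 i).1)
    have := linearFunctional_eq_zero h1 (by rw [map_sub, map_smul, ha, sub_self])
    exact h.2 j i hij.symm a (sub_eq_zero.1 this)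
  have h2 : Module.finrank ℂ W = 2 := by
    rw [hW, finrank_span_eq_card hli, Fintype.card_fin]
  have h3 : Module.finrank ℂ W.dualCoannihilator = 1 := by
    have := Subspace.finrank_add_finrank_dualCoannihilator_eq W
    rw [Module.finrank_fin_fun] at this
    omega
  have hmem : ∀ u, u ∈ W.dualCoannihilator ↔ (eval u (ℓ i) = 0 ∧ eval u (ℓ j) = 0) := by
    intro u
    rw [Submodule.mem_dualCoannihilator, eval_eq_linearFunctional (h.1 i).1,
      eval_eq_linearFunctional (h.1 j).1]
    constructor
    · exact fun hu => ⟨hu _ (Submodule.subset_span ⟨0, rfl⟩), hu _ (Submodule.subset_span ⟨1, rfl⟩)⟩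
    · rintro ⟨hi, hj⟩ φ hφ
      rw [hW, Matrix.range_cons_cons_empty, Submodule.mem_span_pair] at hφ
      obtain ⟨a, b, rfl⟩ := hφ
      simp [hi, hj]
  obtain ⟨v, hv0, hv⟩ := finrank_eq_one_iff'.1 h3
  refine ⟨v, fun h0 => hv0 (Subtype.ext h0), fun u => ?_⟩
  rw [← hmem]
  constructor
  · intro hu
    obtain ⟨c, hc⟩ := hv ⟨u, hu⟩
    exact ⟨c, (congrArg Subtype.val hc).symm⟩
  · rintro ⟨c, rfl⟩
    exact Submodule.smul_mem _ _ v.2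

/-! ### Jacobian ideals -/

theorem pderiv_mem_jacobianIdeal {n : ℕ} (f : MvPolynomial (Fin n) ℂ) (i : Fin n) :
    pderiv i f ∈ jacobianIdeal f :=
  Ideal.subset_span ⟨i, rfl⟩

theorem jacobianIdeal_le_iff {n : ℕ} {f : MvPolynomial (Fin n) ℂ}
    {I : Ideal (MvPolynomial (Fin n) ℂ)} : jacobianIdeal f ≤ I ↔ ∀ i, pderiv i f ∈ I := by
  rw [jacobianIdeal, Ideal.span_le, Set.range_subset_iff]
  rfl

/-- By Euler's identity, a form of positive degree lies in its Jacobian ideal. -/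
theorem mem_jacobianIdeal_self {n m : ℕ} {f : MvPolynomial (Fin n) ℂ} (hf : f.IsHomogeneous m)
    (hm : m ≠ 0) : f ∈ jacobianIdeal f := by
  have h := hf.sum_X_mul_pderiv
  have h1 : f = C ((m : ℂ)⁻¹) * ∑ i, X i * pderiv i f := by
    rw [h, nsmul_eq_mul, ← mul_assoc, ← map_natCast (C (σ := Fin n) (R := ℂ)), ← C_mul,
      inv_mul_cancel₀ (Nat.cast_ne_zero.2 hm), C_1, one_mul]
  have h2 : C ((m : ℂ)⁻¹) * ∑ i, X i * pderiv i f ∈ jacobianIdeal f :=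
    Ideal.mul_mem_left _ _ (Ideal.sum_mem _ fun i _ =>
    Ideal.mul_mem_left _ _ (pderiv_mem_jacobianIdeal f i))
  rwa [← h1] at h2

theorem jacobianIdeal_C_mul {n : ℕ} {c : ℂ} (hc : c ≠ 0) (f : MvPolynomial (Fin n) ℂ) :
    jacobianIdeal (C c * f) = jacobianIdeal f := by
  refine le_antisymm (jacobianIdeal_le_iff.2 fun i => ?_) (jacobianIdeal_le_iff.2 fun i => ?_)
  · rw [pderiv_C_mul]
    exact Ideal.mul_mem_left _ _ (pderiv_mem_jacobianIdeal f i)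
  · have := Ideal.mul_mem_left (jacobianIdeal (C c * f)) (C c⁻¹) (pderiv_mem_jacobianIdeal _ i)
    rwa [pderiv_C_mul, ← mul_assoc, ← C_mul, inv_mul_cancel₀ hc, C_1, one_mul] at this

theorem jacobianIdeal_mul_le {n : ℕ} {h e : MvPolynomial (Fin n) ℂ} (hh : h ∈ jacobianIdeal h) :
    jacobianIdeal (h * e) ≤ jacobianIdeal h := by
  refine jacobianIdeal_le_iff.2 fun i => ?_
  rw [pderiv_mul]
  exact Ideal.add_mem _ (Ideal.mul_mem_right _ _ (pderiv_mem_jacobianIdeal h i))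
    (Ideal.mul_mem_right _ _ hh)

/-- Where the factor `e` is invertible, `h * e` and `h` have the same Jacobian ideal. -/
theorem sq_mul_mem_jacobianIdeal {n : ℕ} {h e x : MvPolynomial (Fin n) ℂ}
    (hhe : h * e ∈ jacobianIdeal (h * e)) (hx : x ∈ jacobianIdeal h) :
    e ^ 2 * x ∈ jacobianIdeal (h * e) := by
  have : jacobianIdeal h ≤ Submodule.comap
      (LinearMap.mulLeft (MvPolynomial (Fin n) ℂ) (e ^ 2)) (jacobianIdeal (h * e)) := by
    refine Submodule.span_le.2 ?_
    rintro _ ⟨i, rfl⟩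
    have h1 : e ^ 2 * pderiv i h = e * pderiv i (h * e) - pderiv i e * (h * e) := by
      rw [pderiv_mul]; ring
    change e ^ 2 * pderiv i h ∈ jacobianIdeal (h * e)
    rw [h1]
    exact Ideal.sub_mem _ (Ideal.mul_mem_left _ _ (pderiv_mem_jacobianIdeal _ i))
      (Ideal.mul_mem_left _ _ hhe)
  exact this hx

/-! ### Consequences of the Nullstellensatz -/

theorem exists_pow_mem_of_eval_eq_zero {n : ℕ} {I : Ideal (MvPolynomial (Fin n) ℂ)}
    {e : MvPolynomial (Fin n) ℂ} (h : ∀ v, (∀ p ∈ I, eval v p = 0) → eval v e = 0) :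
    ∃ N, e ^ N ∈ I := by
  have : e ∈ I.radical := by
    rw [← vanishingIdeal_zeroLocus_eq_radical (K := ℂ) I]
    intro v hv
    have := h v fun p hp => by simpa [coe_aeval_eq_eval] using hv p hp
    simpa [coe_aeval_eq_eval] using this
  exact this

theorem exists_forall_isHomogeneous_mem {n : ℕ} {I : Ideal (MvPolynomial (Fin n) ℂ)}
    (h : ∀ v, (∀ p ∈ I, eval v p = 0) → v = 0) :
    ∃ M, ∀ k, M ≤ k → ∀ p : MvPolynomial (Fin n) ℂ, p.IsHomogeneous k → p ∈ I := by
  have hle : idealOfVars (Fin n) ℂ ≤ I.radical := by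
    refine Ideal.span_le.2 ?_
    rintro _ ⟨i, rfl⟩
    obtain ⟨N, hN⟩ := exists_pow_mem_of_eval_eq_zero (I := I) (e := X i) fun v hv => by
      rw [h v hv]; simp
    exact ⟨N, hN⟩
  obtain ⟨M, hM⟩ := Ideal.exists_pow_le_of_le_radical_of_fg hle (idealOfVars_fg _ _)
  refine ⟨M, fun k hk p hp => hM ((mem_pow_idealOfVars_iff' _ _).2 fun m hm => ?_)⟩
  exact hp.coeff_eq_zero (by omega)

/-! ### Hilbert functions of complete intersections in three variables -/

theorem two_mul_finrank_homogeneousSubmodule (k : ℕ) :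
    2 * Module.finrank ℂ (homogeneousSubmodule (Fin 3) ℂ k) = (k + 1) * (k + 2) := by
  rw [finrank_homogeneousSubmodule, show 3 + k - 1 = k + 2 by omega,
    Nat.choose_symm_of_eq_add rfl, Nat.choose_two_right,
    Nat.mul_div_cancel' (Nat.even_mul_pred_self _).two_dvd, mul_comm]
  rfl

/-- The forms of degree `k` in a principal ideal are the multiples of the generator by the forms
of complementary degree. -/
theorem finrank_idealPiece_span_singleton {n r k : ℕ} {A : MvPolynomial (Fin n) ℂ}
    (hA : A.IsHomogeneous r) (hA0 : A ≠ 0) (hk : r ≤ k) :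
    Module.finrank ℂ (idealPiece (Ideal.span {A}) k) =
      Module.finrank ℂ (homogeneousSubmodule (Fin n) ℂ (k - r)) := by
  have hinj : Function.Injective (LinearMap.mulRight ℂ A) := fun x y hxy =>
    mul_right_cancel₀ hA0 hxy
  rw [(Submodule.equivMapOfInjective _ hinj (homogeneousSubmodule (Fin n) ℂ (k - r))).finrank_eq]
  suffices h : idealPiece (Ideal.span {A}) k =
      (homogeneousSubmodule (Fin n) ℂ (k - r)).map (LinearMap.mulRight ℂ A) by rw [h]
  ext p
  rw [mem_idealPiece, Submodule.mem_map]
  constructor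
  · rintro ⟨hp, hmem⟩
    obtain ⟨a, rfl⟩ := Ideal.mem_span_singleton'.1 hmem
    refine ⟨homogeneousComponent (k - r) a, homogeneousComponent_mem _ _, ?_⟩
    change homogeneousComponent (k - r) a * A = _
    rw [← homogeneousComponent_mul_of_le a hA hk, homogeneousComponent_eq_self hp]
  · rintro ⟨a, ha, rfl⟩
    refine ⟨?_, Ideal.mul_mem_left _ _ (Ideal.mem_span_singleton_self _)⟩
    have := IsHomogeneous.mul ha hA
    rwa [Nat.sub_add_cancel hk] at this

/-- A complete intersection of two curves of degree `r` in `ℙ²` has degree `r ^ 2`. -/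
theorem hilbertFunction_span_pair {r k : ℕ} {A B : MvPolynomial (Fin 3) ℂ}
    (hA : A.IsHomogeneous r) (hB : B.IsHomogeneous r) (hB0 : B ≠ 0)
    (hrel : IsRelPrime A B) (hk : 2 * r ≤ k) :
    hilbertFunction (Ideal.span {A, B}) k = r ^ 2 := by
  let S := MvPolynomial (Fin 3) ℂ
  let U : Submodule ℂ (S × S) :=
    (homogeneousSubmodule (Fin 3) ℂ (k - r)).prod (homogeneousSubmodule (Fin 3) ℂ (k - r))
  let Φ : S × S →ₗ[ℂ] S := (LinearMap.mulRight ℂ A).coprod (LinearMap.mulRight ℂ B)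
  let Ψ : S →ₗ[ℂ] S × S := (LinearMap.mulRight ℂ B).prod (-LinearMap.mulRight ℂ A)
  have hΨ : Function.Injective Ψ := fun x y hxy =>
    mul_right_cancel₀ hB0 (congrArg Prod.fst hxy)
  let E : U ≃ₗ[ℂ] homogeneousSubmodule (Fin 3) ℂ (k - r) × homogeneousSubmodule (Fin 3) ℂ (k - r) :=
    { toFun u := (⟨u.1.1, u.2.1⟩, ⟨u.1.2, u.2.2⟩)
      invFun w := ⟨(w.1.1, w.2.1), ⟨w.1.2, w.2.2⟩⟩
      map_add' _ _ := rfl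
      map_smul' _ _ := rfl }
  have hU : Module.finrank ℂ U =
      2 * Module.finrank ℂ (homogeneousSubmodule (Fin 3) ℂ (k - r)) := by
    rw [E.finrank_eq, Module.finrank_prod, two_mul]
  have : Module.Finite ℂ U := Module.Finite.equiv E.symm
  have himage : U.map Φ = idealPiece (Ideal.span {A, B}) k := by
    ext p
    rw [mem_idealPiece, Submodule.mem_map]
    constructor
    · rintro ⟨⟨a, b⟩, ⟨ha, hb⟩, rfl⟩
      have h1 := IsHomogeneous.mul ha hA
      have h2 := IsHomogeneous.mul hb hB
      rw [Nat.sub_add_cancel (by omega)] at h1 h2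
      exact ⟨h1.add h2, Ideal.mem_span_pair.2 ⟨a, b, rfl⟩⟩
    · rintro ⟨hp, hmem⟩
      obtain ⟨a, b, rfl⟩ := Ideal.mem_span_pair.1 hmem
      refine ⟨(homogeneousComponent (k - r) a, homogeneousComponent (k - r) b),
        ⟨homogeneousComponent_mem _ _, homogeneousComponent_mem _ _⟩, ?_⟩
      change homogeneousComponent (k - r) a * A + homogeneousComponent (k - r) b * B = _
      rw [← homogeneousComponent_mul_of_le a hA (by omega),
        ← homogeneousComponent_mul_of_le b hB (by omega), ← map_add,
        homogeneousComponent_eq_self hp]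
  have hker : U ⊓ Φ.ker = (homogeneousSubmodule (Fin 3) ℂ (k - 2 * r)).map Ψ := by
    ext ⟨a, b⟩
    constructor
    · rintro ⟨⟨ha, hb⟩, h0⟩
      change a * A + b * B = 0 at h0
      obtain ⟨c, hc⟩ : B ∣ a := hrel.symm.dvd_of_dvd_mul_right
        ⟨-b, by linear_combination h0⟩
      have hc' : a = homogeneousComponent (k - 2 * r) c * B := by
        have ha' := homogeneousComponent_eq_self ha
        dsimp only at ha'
        rw [← ha', hc, mul_comm B c,
          homogeneousComponent_mul_of_le c hB (by omega), show k - r - r = k - 2 * r by omega]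
      refine ⟨homogeneousComponent (k - 2 * r) c, homogeneousComponent_mem _ _, ?_⟩
      change (_ * B, -(_ * A)) = _
      refine Prod.ext hc'.symm (mul_right_cancel₀ hB0 ?_)
      dsimp only
      linear_combination A * hc' - h0
    · rintro ⟨c, hc, h⟩
      obtain ⟨rfl, rfl⟩ := Prod.ext_iff.1 h
      have h1 := IsHomogeneous.mul hc hB
      have h2 := (IsHomogeneous.mul hc hA).neg
      rw [show k - 2 * r + r = k - r by omega] at h1 h2
      refine ⟨⟨h1, h2⟩, ?_⟩
      change c * B * A + -(c * A) * B = 0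
      ring
  have h1 := finrank_map_add_finrank_inf_ker U Φ
  rw [himage, hker, hU, (Submodule.equivMapOfInjective _ hΨ _).symm.finrank_eq] at h1
  have h2 := hilbertFunction_add_finrank_idealPiece (Ideal.span {A, B}) k
  have h3 := two_mul_finrank_homogeneousSubmodule k
  have h4 := two_mul_finrank_homogeneousSubmodule (k - r)
  have h5 := two_mul_finrank_homogeneousSubmodule (k - 2 * r)
  obtain ⟨m, rfl⟩ := Nat.exists_eq_add_of_le hk
  rw [show 2 * r + m - r = m + r by omega] at h1 h4
  rw [show 2 * r + m - 2 * r = m by omega] at h1 h5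
  zify at h1 h2 h3 h4 h5 ⊢
  have : (2 : ℤ) * (hilbertFunction (Ideal.span {A, B}) (2 * r + m)) = 2 * r ^ 2 := by
    linear_combination 2 * h2 - 2 * h1 + h3 - 2 * h4 + h5
  omega

/-! ### Multiple points of a line arrangement -/

/-- The product of the forms indexed by `p`. -/
noncomputable def formProduct {n : ℕ} {ι : Type*} (ℓ : ι → MvPolynomial (Fin n) ℂ)
    (p : Finset ι) : MvPolynomial (Fin n) ℂ :=
  ∏ k ∈ p, ℓ k

theorem IsReducedFamily.isHomogeneous_formProduct {n : ℕ} {ι : Type*}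
    {ℓ : ι → MvPolynomial (Fin n) ℂ} (h : IsReducedFamily ℓ) (p : Finset ι) :
    (formProduct ℓ p).IsHomogeneous p.card := by
  have := IsHomogeneous.prod p ℓ (fun _ => 1) fun i _ => (h.1 i).1
  simpa [formProduct] using this

theorem formProduct_erase {n : ℕ} {ι : Type*} [DecidableEq ι] (ℓ : ι → MvPolynomial (Fin n) ℂ)
    {p : Finset ι} {i : ι} (hi : i ∈ p) :
    formProduct ℓ p = ℓ i * formProduct ℓ (p.erase i) :=
  (Finset.mul_prod_erase p ℓ hi).symm

theorem eval_formProduct_eq_zero {n : ℕ} {ι : Type*} {ℓ : ι → MvPolynomial (Fin n) ℂ}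
    {p : Finset ι} {v : Fin n → ℂ} :
    eval v (formProduct ℓ p) = 0 ↔ ∃ i ∈ p, eval v (ℓ i) = 0 := by
  rw [formProduct, map_prod, Finset.prod_eq_zero_iff]

/-- The singular points of an arrangement lie on at least two of its hyperplanes. -/
theorem IsReducedFamily.exists_pair_of_singular {n : ℕ} {ι : Type*}
    {ℓ : ι → MvPolynomial (Fin n) ℂ} (h : IsReducedFamily ℓ) {p : Finset ι} (hp : p.Nonempty)
    {v : Fin n → ℂ} (hv : ∀ q ∈ jacobianIdeal (formProduct ℓ p), eval v q = 0) :
    ∃ i ∈ p, ∃ j ∈ p, i ≠ j ∧ eval v (ℓ i) = 0 ∧ eval v (ℓ j) = 0 := by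
  classical
  obtain ⟨i, hi, hvi⟩ := eval_formProduct_eq_zero.1 (hv _
    (mem_jacobianIdeal_self (h.isHomogeneous_formProduct p) hp.card_pos.ne'))
  obtain ⟨a, ha⟩ := exists_pderiv_ne_zero (h.1 i).1 (h.1 i).2
  have h1 := hv _ (pderiv_mem_jacobianIdeal _ a)
  rw [formProduct_erase ℓ hi, pderiv_mul, pderiv_linear (h.1 i).1] at h1
  simp only [map_add, map_mul, eval_C, hvi, zero_mul, add_zero] at h1
  obtain ⟨j, hj, hvj⟩ := eval_formProduct_eq_zero.1 ((mul_eq_zero.1 h1).resolve_left ha)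
  exact ⟨i, hi, j, Finset.mem_of_mem_erase hj, (Finset.ne_of_mem_erase hj).symm, hvi, hvj⟩

/-- No non-constant polynomial divides all partial derivatives of a reduced arrangement. -/
theorem IsReducedFamily.isUnit_of_dvd_pderiv {n : ℕ} {ι : Type*}
    {ℓ : ι → MvPolynomial (Fin n) ℂ} (h : IsReducedFamily ℓ) {p : Finset ι} (hp : p.Nonempty)
    {q : MvPolynomial (Fin n) ℂ} (hq : ∀ f ∈ jacobianIdeal (formProduct ℓ p), q ∣ f) :
    IsUnit q := by
  classical
  have hself := mem_jacobianIdeal_self (h.isHomogeneous_formProduct p) hp.card_pos.ne'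
  have hne : formProduct ℓ p ≠ 0 := Finset.prod_ne_zero_iff.2 fun i _ => (h.1 i).2
  by_contra hunit
  obtain ⟨π, hπ, hπq⟩ := WfDvdMonoid.exists_irreducible_factor hunit
    (ne_zero_of_dvd_ne_zero hne (hq _ hself))
  obtain ⟨i, hi, hπi⟩ := (hπ.prime.dvd_finsetProd_iff ℓ).1 (hπq.trans (hq _ hself))
  have hassoc := hπ.associated_of_dvd (irreducible_of_linear (h.1 i).1 (h.1 i).2) hπi
  obtain ⟨a, ha⟩ := exists_pderiv_ne_zero (h.1 i).1 (h.1 i).2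
  have hdvd : ℓ i ∣ pderiv a (formProduct ℓ p) :=
    hassoc.symm.dvd.trans (hπq.trans (hq _ (pderiv_mem_jacobianIdeal _ a)))
  have hprime := (irreducible_of_linear (h.1 i).1 (h.1 i).2).prime
  rw [formProduct_erase ℓ hi, pderiv_mul, pderiv_linear (h.1 i).1,
    dvd_add_left (Dvd.intro _ rfl)] at hdvd
  have hCunit : IsUnit (C (constantCoeff (pderiv a (ℓ i))) : MvPolynomial (Fin n) ℂ) :=
    (isUnit_iff_ne_zero.2 ha).map C
  rw [hCunit.dvd_mul_left, formProduct, hprime.dvd_finsetProd_iff] at hdvd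
  obtain ⟨j, hj, hij⟩ := hdvd
  exact h.not_dvd (Finset.ne_of_mem_erase hj).symm hij

open Classical in
/-- The lines of the arrangement that contain the intersection of the lines `i` and `j`. -/
noncomputable def linesThrough {n : ℕ} {ι : Type*} [Fintype ι] (ℓ : ι → MvPolynomial (Fin n) ℂ)
    (i j : ι) : Finset ι :=
  Finset.univ.filter fun k => ∀ u, eval u (ℓ i) = 0 → eval u (ℓ j) = 0 → eval u (ℓ k) = 0

open Classical in
/-- The multiple points of a line arrangement, each given by the set of lines through it. -/
noncomputable def multiplePoints {n : ℕ} {ι : Type*} [Fintype ι]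
    (ℓ : ι → MvPolynomial (Fin n) ℂ) : Finset (Finset ι) :=
  (Finset.univ.filter fun x : ι × ι => x.1 ≠ x.2).image fun x => linesThrough ℓ x.1 x.2

/-- The global Tjurina number `∑ (m_p - 1) ^ 2` of a line arrangement, where `m_p` is the
number of lines through the multiple point `p`. -/
noncomputable def tjurinaNumber {n : ℕ} {ι : Type*} [Fintype ι]
    (ℓ : ι → MvPolynomial (Fin n) ℂ) : ℕ :=
  ∑ p ∈ multiplePoints ℓ, (p.card - 1) ^ 2

/-- `v` spans the line in `ℂ³` over the multiple point given by the set `p` of lines. -/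
structure IsPoint {ι : Type*} (ℓ : ι → MvPolynomial (Fin 3) ℂ) (p : Finset ι)
    (v : Fin 3 → ℂ) : Prop where
  ne_zero : v ≠ 0
  mem_iff : ∀ k, k ∈ p ↔ eval v (ℓ k) = 0
  eq_smul : ∀ i ∈ p, ∀ j ∈ p, i ≠ j → ∀ u, eval u (ℓ i) = 0 → eval u (ℓ j) = 0 →
    ∃ c : ℂ, u = c • v
  one_lt_card : 1 < p.card

theorem IsPoint.exists_pair {ι : Type*} {ℓ : ι → MvPolynomial (Fin 3) ℂ} {p : Finset ι} {v : Fin 3 → ℂ} (hv : IsPoint ℓ p v) :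
    ∃ i ∈ p, ∃ j ∈ p, i ≠ j :=
  Finset.one_lt_card.1 hv.one_lt_card

theorem IsPoint.eq_smul_of_singular {ι : Type*} {ℓ : ι → MvPolynomial (Fin 3) ℂ}
    (h : IsReducedFamily ℓ) {p : Finset ι} {v : Fin 3 → ℂ}
    (hv : IsPoint ℓ p v) {u : Fin 3 → ℂ}
    (hu : ∀ q ∈ jacobianIdeal (formProduct ℓ p), eval u q = 0) : ∃ c : ℂ, u = c • v := by
  obtain ⟨i, hi, j, hj, hij, h1, h2⟩ :=
    h.exists_pair_of_singular (Finset.card_pos.1 (zero_lt_one.trans hv.one_lt_card)) hu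
  exact hv.eq_smul i hi j hj hij u h1 h2

theorem eval_smul_linear {n : ℕ} {p : MvPolynomial (Fin n) ℂ} (hp : p.IsHomogeneous 1) (c : ℂ)
    (v : Fin n → ℂ) : eval (c • v) p = c * eval v p := by
  rw [eval_eq_linearFunctional hp, eval_eq_linearFunctional hp, map_smul, smul_eq_mul]

/-- A multiple point is determined by any two of the lines through it. -/
theorem IsPoint.eq_of_subset {ι : Type*} {ℓ : ι → MvPolynomial (Fin 3) ℂ}
    (h : IsReducedFamily ℓ) {p q : Finset ι} {v w : Fin 3 → ℂ}
    (hv : IsPoint ℓ p v) (hw : IsPoint ℓ q w) (hqp : q ⊆ p) : p = q := by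
  obtain ⟨i, hi, j, hj, hij⟩ := hw.exists_pair
  obtain ⟨c, rfl⟩ := hw.eq_smul i hi j hj hij v ((hv.mem_iff i).1 (hqp hi))
    ((hv.mem_iff j).1 (hqp hj))
  have hc : c ≠ 0 := fun h0 => hv.ne_zero (by rw [h0, zero_smul])
  ext k
  rw [hv.mem_iff, hw.mem_iff, eval_smul_linear (h.1 k).1, mul_eq_zero, or_iff_right hc]

section

variable {ι : Type*} [Fintype ι] {ℓ : ι → MvPolynomial (Fin 3) ℂ}

theorem linesThrough_mem_multiplePoints {i j : ι} (hij : i ≠ j) :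
    linesThrough ℓ i j ∈ multiplePoints ℓ := by
  classical
  exact Finset.mem_image.2 ⟨(i, j), by simpa using hij, rfl⟩

theorem left_mem_linesThrough (i j : ι) : i ∈ linesThrough ℓ i j := by
  simp +contextual [linesThrough]

theorem right_mem_linesThrough (i j : ι) : j ∈ linesThrough ℓ i j := by
  simp +contextual [linesThrough]

theorem IsReducedFamily.exists_isPoint (h : IsReducedFamily ℓ) {p : Finset ι}
    (hp : p ∈ multiplePoints ℓ) : ∃ v, IsPoint ℓ p v := by
  classical
  obtain ⟨⟨i, j⟩, hij, rfl⟩ := Finset.mem_image.1 hp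
  replace hij : i ≠ j := by simpa using hij
  dsimp only
  obtain ⟨v, hv0, hv⟩ := h.exists_spanning_vector hij
  have hmem : ∀ k, k ∈ linesThrough ℓ i j ↔ eval v (ℓ k) = 0 := by
    intro k
    have hvv := (hv v).2 ⟨1, (one_smul _ _).symm⟩
    rw [linesThrough, Finset.mem_filter, and_iff_right (Finset.mem_univ _)]
    refine ⟨fun hk => hk v hvv.1 hvv.2, fun hk u hi hj => ?_⟩
    obtain ⟨c, rfl⟩ := (hv u).1 ⟨hi, hj⟩
    rw [eval_smul_linear (h.1 k).1, hk, mul_zero]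
  refine ⟨v, hv0, hmem, fun a ha b hb hab u hua hub => ?_, Finset.one_lt_card.2
    ⟨i, left_mem_linesThrough i j, j, right_mem_linesThrough i j, hij⟩⟩
  obtain ⟨v', hv'0, hv'⟩ := h.exists_spanning_vector hab
  obtain ⟨c, hc⟩ := (hv' v).1 ⟨(hmem a).1 ha, (hmem b).1 hb⟩
  obtain ⟨c', rfl⟩ := (hv' u).1 ⟨hua, hub⟩
  have hc0 : c ≠ 0 := fun h0 => hv0 (by rw [hc, h0, zero_smul])
  exact ⟨c' / c, by rw [hc, smul_smul, div_mul_cancel₀ _ hc0]⟩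

/-- The lines through a given point of the plane all pass through one multiple point. -/
theorem IsReducedFamily.exists_multiplePoint [Nontrivial ι] (h : IsReducedFamily ℓ)
    {v : Fin 3 → ℂ} (hv : v ≠ 0) :
    ∃ p ∈ multiplePoints ℓ, ∀ k, eval v (ℓ k) = 0 → k ∈ p := by
  by_cases hex : ∃ i j, i ≠ j ∧ eval v (ℓ i) = 0 ∧ eval v (ℓ j) = 0
  · obtain ⟨i, j, hij, hi, hj⟩ := hex
    refine ⟨_, linesThrough_mem_multiplePoints hij, fun k hk => ?_⟩
    obtain ⟨w, hw⟩ := h.exists_isPoint (linesThrough_mem_multiplePoints hij)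
    obtain ⟨c, rfl⟩ := hw.eq_smul i (left_mem_linesThrough i j) j (right_mem_linesThrough i j) hij
      v hi hj
    have hc : c ≠ 0 := fun h0 => hv (by rw [h0, zero_smul])
    rw [eval_smul_linear (h.1 k).1, mul_eq_zero, or_iff_right hc] at hk
    exact (hw.mem_iff k).2 hk
  · push Not at hex
    obtain ⟨i, hi⟩ : ∃ i, ∀ k, eval v (ℓ k) = 0 → k = i := by
      by_cases h0 : ∃ i, eval v (ℓ i) = 0
      · obtain ⟨i, hi⟩ := h0
        exact ⟨i, fun k hk => by_contra fun hne => hex k i hne hk hi⟩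
      · exact ⟨Classical.arbitrary ι, fun k hk => absurd ⟨k, hk⟩ h0⟩
    obtain ⟨j, hj⟩ := exists_ne i
    exact ⟨_, linesThrough_mem_multiplePoints hj.symm, fun k hk => by
      rw [hi k hk]; exact left_mem_linesThrough i j⟩

end

theorem sum_fin_three_cyclic {M : Type*} [AddCommMonoid M] (F : Fin 3 → M) (c : Fin 3) :
    F c + F (c + 1) + F (c + 2) = ∑ a, F a := by
  rw [Fin.sum_univ_three]
  fin_cases c
  · rfl
  · exact (add_comm _ _).trans (add_assoc _ _ _).symm
  · exact (add_assoc _ _ _).trans (add_comm _ _)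

/-- The Jacobian ideal of `m` lines through a point is a complete intersection of two curves of
degree `m - 1`. -/
theorem IsPoint.hilbertFunction_eq {ι : Type*} {ℓ : ι → MvPolynomial (Fin 3) ℂ}
    (h : IsReducedFamily ℓ) {p : Finset ι} {v : Fin 3 → ℂ}
    (hv : IsPoint ℓ p v) {k : ℕ} (hk : 2 * (p.card - 1) ≤ k) :
    hilbertFunction (jacobianIdeal (formProduct ℓ p)) k = (p.card - 1) ^ 2 := by
  classical
  have hne : p.Nonempty := Finset.card_pos.1 (zero_lt_one.trans hv.one_lt_card)
  obtain ⟨c, hc⟩ : ∃ c, v c ≠ 0 := Function.ne_iff.1 hv.ne_zero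
  -- The derivative in the direction of the point vanishes.
  have hdir : ∑ a, C (v a) * pderiv a (formProduct ℓ p) = 0 := by
    let D : Derivation ℂ (MvPolynomial (Fin 3) ℂ) (MvPolynomial (Fin 3) ℂ) :=
      (C (v 0) : MvPolynomial (Fin 3) ℂ) • pderiv 0 +
        (C (v 1) : MvPolynomial (Fin 3) ℂ) • pderiv 1 +
        (C (v 2) : MvPolynomial (Fin 3) ℂ) • pderiv 2
    have hD : ∀ f, D f = ∑ a, C (v a) * pderiv a f := fun f => by
      rw [Fin.sum_univ_three]; rfl
    rw [← hD]
    have : ∀ q ⊆ p, D (formProduct ℓ q) = 0 := by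
      intro q
      induction q using Finset.induction_on with
      | empty => intro _; simp [formProduct]
      | insert i q hi ih =>
        intro hq
        rw [Finset.insert_subset_iff] at hq
        have h1 : formProduct ℓ (insert i q) = ℓ i * formProduct ℓ q := Finset.prod_insert hi
        have h2 : D (ℓ i) = 0 := by
          have h3 := (hv.mem_iff i).1 hq.1
          rw [linear_eq_sum (h.1 i).1] at h3
          simp only [map_sum, map_mul, eval_X, eval_C] at h3
          rw [hD, Finset.sum_congr rfl fun a _ => by rw [pderiv_linear (h.1 i).1 a]]
          simp only [← map_mul, ← map_sum, h3, map_zero]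
        rw [h1, D.leibniz, ih hq.2, h2, smul_zero, smul_zero, add_zero]
    exact this p subset_rfl
  set A := pderiv (c + 1) (formProduct ℓ p) with hA
  set B := pderiv (c + 2) (formProduct ℓ p) with hB
  have hsum : C (v c) * pderiv c (formProduct ℓ p) + C (v (c + 1)) * A + C (v (c + 2)) * B = 0 := by
    rw [← hdir, ← sum_fin_three_cyclic _ c, hA, hB]
  have hspan : jacobianIdeal (formProduct ℓ p) = Ideal.span {A, B} := by
    refine le_antisymm (jacobianIdeal_le_iff.2 fun a => ?_) (Ideal.span_le.2 ?_)
    · have hcases : a = c ∨ a = c + 1 ∨ a = c + 2 :=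
        (by decide : ∀ a c : Fin 3, a = c ∨ a = c + 1 ∨ a = c + 2) a c
      rcases hcases with rfl | rfl | rfl
      · have h1 : pderiv a (formProduct ℓ p) =
            (-C (v a)⁻¹ * C (v (a + 1))) * A + (-C (v a)⁻¹ * C (v (a + 2))) * B := by
          have h2 : (C (v a)⁻¹ * C (v a) : MvPolynomial (Fin 3) ℂ) = 1 := by
            rw [← C_mul, inv_mul_cancel₀ hc, C_1]
          linear_combination C (v a)⁻¹ * hsum - pderiv a (formProduct ℓ p) * h2
        exact Ideal.mem_span_pair.2 ⟨_, _, h1.symm⟩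
      · exact Ideal.subset_span (by simp [hA])
      · exact Ideal.subset_span (by simp [hB])
    · rintro _ (rfl | rfl)
      · exact pderiv_mem_jacobianIdeal _ _
      · exact pderiv_mem_jacobianIdeal _ _
  have hrel : IsRelPrime A B := by
    intro q hqA hqB
    refine h.isUnit_of_dvd_pderiv hne fun f hf => ?_
    rw [hspan] at hf
    obtain ⟨a, b, rfl⟩ := Ideal.mem_span_pair.1 hf
    exact dvd_add (hqA.mul_left a) (hqB.mul_left b)
  have hAh : A.IsHomogeneous (p.card - 1) := (h.isHomogeneous_formProduct p).pderiv
  have hBh : B.IsHomogeneous (p.card - 1) := (h.isHomogeneous_formProduct p).pderiv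
  have hcard := hv.one_lt_card
  have hunit : ∀ F : MvPolynomial (Fin 3) ℂ, F.IsHomogeneous (p.card - 1) → ¬ IsUnit F := by
    intro F hF hu
    obtain ⟨r, hr, rfl⟩ := MvPolynomial.isUnit_iff_eq_C_of_isReduced.1 hu
    have := hF.inj_right (isHomogeneous_C _ r) (by simpa using hr.ne_zero)
    omega
  rw [hspan]
  refine hilbertFunction_span_pair hAh hBh (fun h0 => ?_) hrel hk
  exact hunit A hAh (hrel dvd_rfl (h0 ▸ dvd_zero A))

/-! ### The Hilbert function of the Jacobian algebra of a line arrangement -/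

theorem finrank_le_sum_of_le_iSup {V ι : Type*} [AddCommGroup V] [Module ℂ V] [Fintype ι]
    (W : ι → Submodule ℂ V) [∀ i, Module.Finite ℂ (W i)] {U : Submodule ℂ V} (hU : U ≤ ⨆ i, W i) :
    Module.finrank ℂ U ≤ ∑ i, Module.finrank ℂ (W i) := by
  classical
  refine (Submodule.finrank_mono hU).trans ?_
  rw [← Finset.sup_univ_eq_iSup]
  suffices h : ∀ s : Finset ι, Module.finrank ℂ (s.sup W : Submodule ℂ V) ≤
      ∑ i ∈ s, Module.finrank ℂ (W i) from h Finset.univ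
  intro s
  induction s using Finset.induction_on with
  | empty => simp
  | insert i s hi ih =>
    rw [Finset.sup_insert, Finset.sum_insert hi]
    have : Module.Finite ℂ (s.sup W : Submodule ℂ V) := Submodule.finite_finset_sup _ _
    exact (Submodule.finrank_add_le_finrank_add_finrank _ _).trans (by gcongr)

/-- If `V(I) ∩ V(e) = {0}` for an ideal `I` with homogeneous generators `h i` and a form `e`, then
in large degrees every form is congruent modulo `I` to a homogeneous multiple of `e`. -/
theorem exists_forall_congr_multiple {n m : ℕ} {ι : Type*} [Fintype ι]
    {h : ι → MvPolynomial (Fin n) ℂ} {d : ι → ℕ} (hh : ∀ i, (h i).IsHomogeneous (d i))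
    {e : MvPolynomial (Fin n) ℂ} (he : e.IsHomogeneous m)
    (hV : ∀ v, (∀ p ∈ Ideal.span (Set.range h), eval v p = 0) → eval v e = 0 → v = 0) :
    ∃ M, ∀ k, M ≤ k → ∀ p : MvPolynomial (Fin n) ℂ, p.IsHomogeneous k →
      ∃ c, (c * e).IsHomogeneous k ∧ p - c * e ∈ Ideal.span (Set.range h) := by
  obtain ⟨M, hM⟩ := exists_forall_isHomogeneous_mem
      (I := Ideal.span (Set.range fun o : Option ι => o.elim e h)) fun v hv => by
    refine hV v (fun p hp => hv p (Ideal.span_mono ?_ hp)) (hv e (Ideal.subset_span ⟨none, rfl⟩))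
    rintro _ ⟨i, rfl⟩
    exact ⟨some i, rfl⟩
  refine ⟨M + m, fun k hk p hp => ?_⟩
  obtain ⟨a, ha, -, hsum⟩ := exists_isHomogeneous_of_mem_span
    (h := fun o : Option ι => o.elim e h) (e := fun o => o.elim m d)
    (by rintro (_ | i); exacts [he, hh i]) hp (hM k (by omega) p hp)
  refine ⟨a none, ?_, ?_⟩
  · have := (ha none).mul he
    rwa [Option.elim_none, Nat.sub_add_cancel (by omega)] at this
  · rw [hsum, Fintype.sum_option, Option.elim_none, add_sub_cancel_left]
    exact Ideal.sum_mem _ fun i _ => Ideal.mul_mem_left _ _ (Ideal.subset_span ⟨i, rfl⟩)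

/-- If the forms `h i` have no common zero except the origin, then in large degrees every form is
a combination of the `h i`. -/
theorem exists_forall_eq_sum {n : ℕ} {ι : Type*} [Fintype ι]
    {h : ι → MvPolynomial (Fin n) ℂ} {d : ι → ℕ} (hh : ∀ i, (h i).IsHomogeneous (d i))
    (hV : ∀ v, (∀ i, eval v (h i) = 0) → v = 0) :
    ∃ M, ∀ k, M ≤ k → ∀ p : MvPolynomial (Fin n) ℂ, p.IsHomogeneous k →
      ∃ a : ι → MvPolynomial (Fin n) ℂ, (∀ i, (a i).IsHomogeneous (k - d i)) ∧
        p = ∑ i, a i * h i := by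
  obtain ⟨M, hM⟩ := exists_forall_isHomogeneous_mem (I := Ideal.span (Set.range h))
    fun v hv => hV v fun i => hv _ (Ideal.subset_span ⟨i, rfl⟩)
  refine ⟨M, fun k hk p hp => ?_⟩
  obtain ⟨a, ha, -, hsum⟩ := exists_isHomogeneous_of_mem_span hh hp (hM k hk p hp)
  exact ⟨a, ha, hsum⟩

section

variable {ι : Type*} [Fintype ι] {ℓ : ι → MvPolynomial (Fin 3) ℂ}

open Classical in
/-- A power of the product of the lines not through `p` lies in the Jacobian ideal of the lines
through any other multiple point `q`, with a uniform exponent. -/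
theorem IsReducedFamily.exists_exponent (h : IsReducedFamily ℓ) :
    ∃ N, 2 ≤ N ∧ ∀ p ∈ multiplePoints ℓ, ∀ q ∈ multiplePoints ℓ, p ≠ q →
      formProduct ℓ pᶜ ^ N ∈ jacobianIdeal (formProduct ℓ q) := by
  have key : ∀ p q : Finset ι, ∃ N, p ∈ multiplePoints ℓ → q ∈ multiplePoints ℓ → p ≠ q →
      formProduct ℓ pᶜ ^ N ∈ jacobianIdeal (formProduct ℓ q) := by
    intro p q
    by_cases hpq : p ∈ multiplePoints ℓ ∧ q ∈ multiplePoints ℓ ∧ p ≠ q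
    · obtain ⟨hp, hq, hne⟩ := hpq
      obtain ⟨v, hv⟩ := h.exists_isPoint hp
      obtain ⟨w, hw⟩ := h.exists_isPoint hq
      obtain ⟨N, hN⟩ := exists_pow_mem_of_eval_eq_zero (I := jacobianIdeal (formProduct ℓ q))
          (e := formProduct ℓ pᶜ) fun u hu => by
        obtain ⟨c, rfl⟩ := hw.eq_smul_of_singular h hu
        obtain ⟨k, hkq, hkp⟩ : ∃ k ∈ q, k ∉ p := by
          by_contra! hsub
          exact hne (hv.eq_of_subset h hw hsub)
        refine eval_formProduct_eq_zero.2 ⟨k, Finset.mem_compl.2 hkp, ?_⟩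
        rw [eval_smul_linear (h.1 k).1, (hw.mem_iff k).1 hkq, mul_zero]
      exact ⟨N, fun _ _ _ => hN⟩
    · exact ⟨0, fun hp hq hne => absurd ⟨hp, hq, hne⟩ hpq⟩
  choose N hN using key
  refine ⟨2 + ∑ p, ∑ q, N p q, by omega, fun p hp q hq hne => ?_⟩
  refine Ideal.mem_of_dvd _ (pow_dvd_pow _ ?_) (hN p q hp hq hne)
  have h1 : N p q ≤ ∑ q', N p q' :=
    Finset.single_le_sum (f := N p) (fun _ _ => Nat.zero_le _) (Finset.mem_univ q)
  have h2 : ∑ q', N p q' ≤ ∑ p', ∑ q', N p' q' :=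
    Finset.single_le_sum (f := fun p' => ∑ q', N p' q') (fun _ _ => Nat.zero_le _)
      (Finset.mem_univ p)
  omega

open Classical in
/-- In large degrees the Jacobian algebra is spanned by the images of the Jacobian algebras of the
multiple points `p` under multiplication by the squared product of the lines not through `p`. -/
theorem IsReducedFamily.jacobianHilbertFunction_le [Nontrivial ι] (h : IsReducedFamily ℓ) :
    ∃ M, ∀ k, M ≤ k →
      hilbertFunction (jacobianIdeal (formProduct ℓ Finset.univ)) k ≤ tjurinaNumber ℓ := by
  let e : multiplePoints ℓ → MvPolynomial (Fin 3) ℂ := fun p => formProduct ℓ p.1ᶜ ^ 2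
  let d : multiplePoints ℓ → ℕ := fun p => p.1ᶜ.card * 2
  have he : ∀ p, (e p).IsHomogeneous (d p) := fun p => (h.isHomogeneous_formProduct _).pow 2
  set J := jacobianIdeal (formProduct ℓ Finset.univ) with hJ
  have hmem : ∀ (p : multiplePoints ℓ), ∀ x ∈ jacobianIdeal (formProduct ℓ p.1), x * e p ∈ J := by
    intro p x hx
    have h1 : formProduct ℓ Finset.univ = formProduct ℓ p.1 * formProduct ℓ p.1ᶜ :=
      (Finset.prod_mul_prod_compl _ _).symm
    have h2 := mem_jacobianIdeal_self (h.isHomogeneous_formProduct Finset.univ)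
      Finset.univ_nonempty.card_pos.ne'
    rw [h1] at h2
    have h3 := sq_mul_mem_jacobianIdeal h2 hx
    rwa [← h1, mul_comm (_ ^ 2) x] at h3
  obtain ⟨M, hM⟩ := exists_forall_eq_sum he fun v hv => by
    by_contra hv0
    obtain ⟨p, hp, hpv⟩ := h.exists_multiplePoint hv0
    have h1 := hv ⟨p, hp⟩
    simp only [e, map_pow] at h1
    obtain ⟨k, hk, hk0⟩ := eval_formProduct_eq_zero.1 (pow_eq_zero_iff two_ne_zero |>.1 h1)
    exact Finset.mem_compl.1 hk (hpv k hk0)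
  refine ⟨M + 4 * Fintype.card ι, fun k hk => ?_⟩
  let L : multiplePoints ℓ → MvPolynomial (Fin 3) ℂ →ₗ[ℂ] MvPolynomial (Fin 3) ℂ ⧸ J := fun p =>
    (Ideal.Quotient.mkₐ ℂ J).toLinearMap ∘ₗ LinearMap.mulRight ℂ (e p)
  let W := fun p => (homogeneousSubmodule (Fin 3) ℂ (k - d p)).map (L p)
  have hle : (homogeneousSubmodule (Fin 3) ℂ k).map (Ideal.Quotient.mkₐ ℂ J).toLinearMap ≤
      ⨆ p, W p := by
    rintro _ ⟨x, hx, rfl⟩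
    obtain ⟨a, ha, rfl⟩ := hM k (by omega) x hx
    rw [map_sum]
    exact Submodule.sum_mem _ fun p _ => Submodule.mem_iSup_of_mem p ⟨a p, ha p, rfl⟩
  refine (finrank_le_sum_of_le_iSup W hle).trans ?_
  rw [tjurinaNumber, ← Finset.sum_coe_sort (multiplePoints ℓ)]
  refine Finset.sum_le_sum fun p _ => ?_
  obtain ⟨v, hv⟩ := h.exists_isPoint p.2
  have hcard : p.1ᶜ.card ≤ Fintype.card ι := Finset.card_le_univ _
  have hcard' : p.1.card ≤ Fintype.card ι := Finset.card_le_univ _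
  rw [← hv.hilbertFunction_eq h (k := k - d p) (by simp only [d]; omega)]
  exact finrank_map_le_hilbertFunction (L p) fun x _ hx =>
    Ideal.Quotient.eq_zero_iff_mem.2 (hmem p x hx)

open Classical in
/-- In large degrees the Jacobian algebra maps onto the product of the Jacobian algebras of the
multiple points. -/
theorem IsReducedFamily.le_jacobianHilbertFunction (h : IsReducedFamily ℓ) :
    ∃ M, ∀ k, M ≤ k →
      tjurinaNumber ℓ ≤ hilbertFunction (jacobianIdeal (formProduct ℓ Finset.univ)) k := by
  obtain ⟨N, hN2, hN⟩ := h.exists_exponent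
  let I : multiplePoints ℓ → Ideal (MvPolynomial (Fin 3) ℂ) := fun p =>
    jacobianIdeal (formProduct ℓ p.1)
  let e : multiplePoints ℓ → MvPolynomial (Fin 3) ℂ := fun p => formProduct ℓ p.1ᶜ ^ N
  have he : ∀ p, (e p).IsHomogeneous (p.1ᶜ.card * N) :=
    fun p => (h.isHomogeneous_formProduct _).pow N
  have hlift : ∀ p, ∃ M, ∀ k, M ≤ k → ∀ x : MvPolynomial (Fin 3) ℂ, x.IsHomogeneous k →
      ∃ c, (c * e p).IsHomogeneous k ∧ x - c * e p ∈ I p := by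
    intro p
    obtain ⟨v, hv⟩ := h.exists_isPoint p.2
    refine exists_forall_congr_multiple (d := fun _ => p.1.card - 1)
      (fun i => (h.isHomogeneous_formProduct p.1).pderiv) (he p) fun u hu hue => ?_
    obtain ⟨c, rfl⟩ := hv.eq_smul_of_singular h hu
    by_contra hc
    simp only [e, map_pow] at hue
    obtain ⟨k, hk, hk0⟩ := eval_formProduct_eq_zero.1 (eq_zero_of_pow_eq_zero hue)
    rw [eval_smul_linear (h.1 k).1, mul_eq_zero,
      or_iff_right (fun h0 => hc (by rw [h0, zero_smul]))] at hk0
    exact Finset.mem_compl.1 hk ((hv.mem_iff k).2 hk0)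
  choose M hM using hlift
  refine ⟨∑ p, M p + 2 * Fintype.card ι, fun k hk => ?_⟩
  let L : MvPolynomial (Fin 3) ℂ →ₗ[ℂ] ∀ p, MvPolynomial (Fin 3) ℂ ⧸ I p :=
    LinearMap.pi fun p => (Ideal.Quotient.mkₐ ℂ (I p)).toLinearMap
  have hIL : ∀ x, x.IsHomogeneous k → x ∈ jacobianIdeal (formProduct ℓ Finset.univ) → L x = 0 := by
    intro x _ hx
    funext p
    obtain ⟨v, hv⟩ := h.exists_isPoint p.2
    have h1 : formProduct ℓ Finset.univ = formProduct ℓ p.1 * formProduct ℓ p.1ᶜ :=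
      (Finset.prod_mul_prod_compl _ _).symm
    refine Ideal.Quotient.eq_zero_iff_mem.2 (jacobianIdeal_mul_le
      (mem_jacobianIdeal_self (h.isHomogeneous_formProduct p.1) ?_) (h1 ▸ hx))
    exact (zero_lt_one.trans hv.one_lt_card).ne'
  refine le_trans ?_ (finrank_map_le_hilbertFunction L hIL)
  let W : ∀ p, Submodule ℂ (MvPolynomial (Fin 3) ℂ ⧸ I p) := fun p =>
    (homogeneousSubmodule (Fin 3) ℂ k).map (Ideal.Quotient.mkₐ ℂ (I p)).toLinearMap
  have hfin : ∀ p, Module.Finite ℂ (W p) := fun p => Module.Finite.map _ _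
  have hrange : Submodule.pi Set.univ W ≤ (homogeneousSubmodule (Fin 3) ℂ k).map L := by
    intro w hw
    choose a ha haw using fun p => hw p (Set.mem_univ p)
    choose c hc hac using fun p => hM p k (le_trans (le_trans (Finset.single_le_sum (f := M)
      (fun _ _ => Nat.zero_le _) (Finset.mem_univ p)) (Nat.le_add_right _ _)) hk) (a p) (ha p)
    refine ⟨∑ p, c p * e p, Submodule.sum_mem _ fun p _ => hc p, funext fun q => ?_⟩
    change Ideal.Quotient.mk (I q) _ = w q
    rw [← haw q, map_sum, Finset.sum_eq_single q]
    · exact ((Ideal.Quotient.eq).2 (hac q)).symm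
    · intro p _ hpq
      exact Ideal.Quotient.eq_zero_iff_mem.2
        (Ideal.mul_mem_left _ _ (hN p p.2 q q.2 fun h0 => hpq (Subtype.ext h0)))
    · exact fun hq => absurd (Finset.mem_univ q) hq
  refine le_trans (le_of_eq ?_) (Submodule.finrank_mono hrange)
  rw [finrank_submodule_pi, tjurinaNumber,
    ← Finset.sum_coe_sort (multiplePoints ℓ)]
  refine Finset.sum_congr rfl fun p _ => ?_
  obtain ⟨v, hv⟩ := h.exists_isPoint p.2
  have hcard' : p.1.card ≤ Fintype.card ι := Finset.card_le_univ _
  exact (hv.hilbertFunction_eq h (by omega)).symm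

/-- The Hilbert polynomial of the Jacobian algebra of a line arrangement is the constant
`∑ (m_p - 1) ^ 2`. -/
theorem IsReducedFamily.exists_hilbertFunction_eq_tjurinaNumber [Nontrivial ι]
    (h : IsReducedFamily ℓ) :
    ∃ M, ∀ k, M ≤ k →
      hilbertFunction (jacobianIdeal (formProduct ℓ Finset.univ)) k = tjurinaNumber ℓ := by
  obtain ⟨M₁, h₁⟩ := h.jacobianHilbertFunction_le
  obtain ⟨M₂, h₂⟩ := h.le_jacobianHilbertFunction
  exact ⟨max M₁ M₂, fun k hk => le_antisymm (h₁ k (le_of_max_le_left hk))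
    (h₂ k (le_of_max_le_right hk))⟩

end

/-! ### The Jacobian algebra of a cone -/

/-- Polynomials in `n + 1` variables as polynomials in the last variable. The rotation moves this
variable to the position that `finSuccEquiv` singles out. -/
noncomputable def lastVariableEquiv (n : ℕ) :
    MvPolynomial (Fin (n + 1)) ℂ ≃ₐ[ℂ] Polynomial (MvPolynomial (Fin n) ℂ) :=
  (renameEquiv ℂ (finRotate (n + 1))).trans (finSuccEquiv ℂ n)

theorem lastVariableEquiv_X_last (n : ℕ) :
    lastVariableEquiv n (X (Fin.last n)) = Polynomial.X := by
  simp [lastVariableEquiv, finSuccEquiv_X_zero]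

theorem lastVariableEquiv_rename {n : ℕ} (p : MvPolynomial (Fin n) ℂ) :
    lastVariableEquiv n (rename Fin.castSucc p) = Polynomial.C p := by
  have : ((lastVariableEquiv n).toAlgHom.comp (rename Fin.castSucc)) =
      (Algebra.ofId (MvPolynomial (Fin n) ℂ) (Polynomial (MvPolynomial (Fin n) ℂ))).restrictScalars
        ℂ := by
    refine algHom_ext fun i => ?_
    simp [lastVariableEquiv, finSuccEquiv_X_succ, Algebra.ofId_apply]
  exact DFunLike.congr_fun this p

theorem MvPolynomial.IsHomogeneous.coeff_lastVariableEquiv {n k : ℕ} {p : MvPolynomial (Fin (n + 1)) ℂ}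
    (hp : p.IsHomogeneous k) {i : ℕ} (hi : i ≤ k) :
    ((lastVariableEquiv n p).coeff i).IsHomogeneous (k - i) :=
  (hp.rename_isHomogeneous (f := finRotate (n + 1))).finSuccEquiv_coeff_isHomogeneous i (k - i)
    (by omega)

theorem MvPolynomial.IsHomogeneous.coeff_lastVariableEquiv_eq_zero {n k : ℕ}
    {p : MvPolynomial (Fin (n + 1)) ℂ} (hp : p.IsHomogeneous k) {i : ℕ} (hi : k < i) :
    (lastVariableEquiv n p).coeff i = 0 := by
  ext m
  have h := hp.rename_isHomogeneous (f := finRotate (n + 1))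
  change coeff m ((finSuccEquiv ℂ n (rename (finRotate (n + 1)) p)).coeff i) = _
  rw [finSuccEquiv_coeff_coeff, h.coeff_eq_zero, coeff_zero]
  rw [Finsupp.degree_eq_sum, Fin.sum_univ_succ, Finsupp.cons_zero]
  omega

theorem pderiv_last_rename {n : ℕ} (g : MvPolynomial (Fin n) ℂ) :
    pderiv (Fin.last n) (rename Fin.castSucc g) = 0 := by
  classical
  refine pderiv_eq_zero_of_notMem_vars fun h => ?_
  obtain ⟨i, -, hi⟩ := Finset.mem_image.1 (vars_rename _ _ h)
  exact (Fin.castSucc_lt_last i).ne hi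

theorem pderiv_last_coneEquation {n : ℕ} (g : MvPolynomial (Fin n) ℂ) :
    pderiv (Fin.last n) (coneEquation g) = rename Fin.castSucc g := by
  rw [coneEquation, pderiv_mul, pderiv_X_self, pderiv_last_rename, one_mul, mul_zero, add_zero]

theorem pderiv_castSucc_coneEquation {n : ℕ} (g : MvPolynomial (Fin n) ℂ) (i : Fin n) :
    pderiv i.castSucc (coneEquation g) = X (Fin.last n) * rename Fin.castSucc (pderiv i g) := by
  rw [coneEquation, pderiv_mul, pderiv_X_of_ne (Fin.castSucc_lt_last i).ne', zero_mul, zero_add,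
    pderiv_rename (Fin.castSucc_injective n)]

theorem polynomial_eq_add_sum {R : Type*} [CommRing R] (P : Polynomial R) :
    P = Polynomial.C (P.coeff 0) + ∑ i ∈ Finset.range P.natDegree,
      Polynomial.X ^ i * (Polynomial.X * Polynomial.C (P.coeff (i + 1))) := by
  conv_lhs => rw [Polynomial.as_sum_range_C_mul_X_pow P, Finset.sum_range_succ', add_comm,
    pow_zero, mul_one]
  refine congrArg _ (Finset.sum_congr rfl fun i _ => ?_)
  rw [pow_succ, mul_comm, mul_assoc]

/-- `∑ wⁱ aᵢ` lies in the Jacobian ideal of the cone `w g` if and only if `a₀ ∈ (g)` and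
`aᵢ ∈ J_g` for `i ≥ 1`. -/
theorem mem_jacobianIdeal_coneEquation {n : ℕ} {g : MvPolynomial (Fin n) ℂ}
    (hg : g ∈ jacobianIdeal g) (p : MvPolynomial (Fin (n + 1)) ℂ) :
    p ∈ jacobianIdeal (coneEquation g) ↔
      (lastVariableEquiv n p).coeff 0 ∈ Ideal.span {g} ∧
        ∀ i, (lastVariableEquiv n p).coeff (i + 1) ∈ jacobianIdeal g := by
  have hspan : Ideal.span {g} ≤ jacobianIdeal g := (Ideal.span_singleton_le_iff_mem _).2 hg
  constructor
  · have hle : jacobianIdeal (coneEquation g) ≤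
        (((jacobianIdeal g).map Polynomial.C) ⊓
          (Ideal.span {g}).comap Polynomial.constantCoeff).comap (lastVariableEquiv n) := by
      refine jacobianIdeal_le_iff.2 fun i => ?_
      rw [Ideal.mem_comap]
      refine Fin.lastCases ?_ (fun i => ?_) i
      · rw [pderiv_last_coneEquation, lastVariableEquiv_rename]
        refine ⟨Ideal.mem_map_of_mem _ hg, ?_⟩
        rw [SetLike.mem_coe, Ideal.mem_comap]
        simp
      · rw [pderiv_castSucc_coneEquation, map_mul, lastVariableEquiv_rename,
          lastVariableEquiv_X_last]
        refine ⟨Ideal.mul_mem_left _ _ (Ideal.mem_map_of_mem _ (pderiv_mem_jacobianIdeal g i)), ?_⟩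
        rw [SetLike.mem_coe, Ideal.mem_comap]
        simp
    intro hp
    obtain ⟨h1, h2⟩ := hle hp
    exact ⟨h2, fun i => Ideal.mem_map_C_iff.1 h1 _⟩
  · rintro ⟨h0, h1⟩
    have hC : ∀ q ∈ jacobianIdeal g,
        X (Fin.last n) * rename Fin.castSucc q ∈ jacobianIdeal (coneEquation g) := by
      intro q hq
      induction hq using Submodule.span_induction with
      | mem x hx =>
        obtain ⟨i, rfl⟩ := hx
        dsimp only
        rw [← pderiv_castSucc_coneEquation]
        exact pderiv_mem_jacobianIdeal _ _
      | zero => simp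
      | add x y _ _ hx hy =>
        rw [map_add, mul_add]
        exact Ideal.add_mem _ hx hy
      | smul a x _ hx =>
        rw [smul_eq_mul, map_mul, mul_left_comm]
        exact Ideal.mul_mem_left _ _ hx
    have hgmem : rename Fin.castSucc g ∈ jacobianIdeal (coneEquation g) :=
      pderiv_last_coneEquation g ▸ pderiv_mem_jacobianIdeal _ _
    have hp : p = rename Fin.castSucc ((lastVariableEquiv n p).coeff 0) +
        ∑ i ∈ Finset.range ((lastVariableEquiv n p).natDegree), X (Fin.last n) ^ i *
          (X (Fin.last n) * rename Fin.castSucc ((lastVariableEquiv n p).coeff (i + 1))) := by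
      apply (lastVariableEquiv n).injective
      simp only [map_add, map_sum, map_mul, map_pow, lastVariableEquiv_X_last,
        lastVariableEquiv_rename]
      exact polynomial_eq_add_sum _
    rw [hp]
    refine Ideal.add_mem _ ?_ (Ideal.sum_mem _ fun i _ => Ideal.mul_mem_left _ _ (hC _ (h1 i)))
    obtain ⟨a, ha⟩ := Ideal.mem_span_singleton'.1 h0
    rw [← ha, map_mul]
    exact Ideal.mul_mem_left _ _ hgmem

/-- The Jacobian algebra of the cone over `g` is the sum of `S / (g)` and of the shifts by
`1, 2, 3, …` of the Jacobian algebra of `g`. -/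
theorem hilbertFunction_coneEquation {n : ℕ} {g : MvPolynomial (Fin n) ℂ}
    (hg : g ∈ jacobianIdeal g) (k : ℕ) :
    hilbertFunction (jacobianIdeal (coneEquation g)) k =
      hilbertFunction (Ideal.span {g}) k +
        ∑ j ∈ Finset.range k, hilbertFunction (jacobianIdeal g) j := by
  let I : Fin (k + 1) → Ideal (MvPolynomial (Fin n) ℂ) :=
    fun i => if i = 0 then Ideal.span {g} else jacobianIdeal g
  let L : MvPolynomial (Fin (n + 1)) ℂ →ₗ[ℂ] ∀ i, MvPolynomial (Fin n) ℂ ⧸ I i :=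
    LinearMap.pi fun i => (Ideal.Quotient.mkₐ ℂ (I i)).toLinearMap ∘ₗ
      ((Polynomial.lcoeff _ i.1).restrictScalars ℂ) ∘ₗ (lastVariableEquiv n).toLinearMap
  have hL : ∀ p i, L p i = Ideal.Quotient.mk (I i) ((lastVariableEquiv n p).coeff i) :=
    fun p i => rfl
  rw [← finrank_map_eq_hilbertFunction (k := k) L]
  · let W : ∀ i, Submodule ℂ (MvPolynomial (Fin n) ℂ ⧸ I i) := fun i =>
      (homogeneousSubmodule (Fin n) ℂ (k - i)).map (Ideal.Quotient.mkₐ ℂ (I i)).toLinearMap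
    have hfin : ∀ i, Module.Finite ℂ (W i) := fun i => Module.Finite.map _ _
    have himage : (homogeneousSubmodule (Fin (n + 1)) ℂ k).map L = Submodule.pi Set.univ W := by
      ext w
      constructor
      · rintro ⟨p, hp, rfl⟩ i -
        exact ⟨_, IsHomogeneous.coeff_lastVariableEquiv hp (Nat.lt_succ_iff.1 i.2), rfl⟩
      · intro hw
        choose a ha haw using fun i => hw i (Set.mem_univ i)
        refine ⟨∑ i : Fin (k + 1), X (Fin.last n) ^ i.1 * rename Fin.castSucc (a i),
          Submodule.sum_mem _ fun i _ => ?_, funext fun i => ?_⟩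
        · have := ((isHomogeneous_X ℂ (Fin.last n)).pow i.1).mul
            ((show (a i).IsHomogeneous _ from ha i).rename_isHomogeneous (f := Fin.castSucc))
          rwa [one_mul, Nat.add_sub_cancel' (Nat.lt_succ_iff.1 i.2)] at this
        · rw [hL, ← haw i]
          simp only [map_sum, map_mul, map_pow, lastVariableEquiv_X_last, lastVariableEquiv_rename,
            Polynomial.finsetSum_coeff, Polynomial.coeff_X_pow_mul', Polynomial.coeff_C]
          change _ = Ideal.Quotient.mk (I i) (a i)
          rw [← map_sum]
          congr 1
          rw [Finset.sum_eq_single i]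
          · simp
          · intro j _ hj
            have : j.1 ≠ i.1 := fun h => hj (Fin.ext h)
            split_ifs <;> first | rfl | omega
          · simp
    rw [himage, finrank_submodule_pi, Fin.sum_univ_succ]
    congr 1
    rw [← Finset.sum_range_reflect, Finset.sum_range]
    refine Finset.sum_congr rfl fun i _ => ?_
    change hilbertFunction (I i.succ) (k - (i.1 + 1)) = _
    rw [show I i.succ = jacobianIdeal g from if_neg (Fin.succ_ne_zero i)]
    congr 1
    omega
  · intro p hp
    rw [mem_jacobianIdeal_coneEquation hg, funext_iff]
    constructor
    · intro h
      refine ⟨?_, fun i => ?_⟩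
      · exact Ideal.Quotient.eq_zero_iff_mem.1 (h 0)
      · by_cases hi : i + 1 ≤ k
        · have := Ideal.Quotient.eq_zero_iff_mem.1 (h ⟨i + 1, by omega⟩)
          rwa [show I ⟨i + 1, _⟩ = jacobianIdeal g from if_neg (by simp [Fin.ext_iff])] at this
        · rw [IsHomogeneous.coeff_lastVariableEquiv_eq_zero hp (by omega)]
          exact Ideal.zero_mem _
    · rintro ⟨h0, h1⟩ i
      rw [hL]
      refine Ideal.Quotient.eq_zero_iff_mem.2 ?_
      refine Fin.cases ?_ (fun i => ?_) i
      · exact h0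
      · rw [show I i.succ = jacobianIdeal g from if_neg (Fin.succ_ne_zero i)]
        exact h1 i

/-! ### Graded Betti numbers determine the Hilbert function -/

/-- The piece of degree `k` of the twisted module `S(-s)`. -/
noncomputable def twistedPiece (n k s : ℕ) : Submodule ℂ (MvPolynomial (Fin n) ℂ) :=
  if s ≤ k then homogeneousSubmodule (Fin n) ℂ (k - s) else ⊥

/-- The projection of `S(-s)` to its piece of degree `k`. -/
noncomputable def twistedComponent (n k s : ℕ) :
    MvPolynomial (Fin n) ℂ →ₗ[ℂ] MvPolynomial (Fin n) ℂ :=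
  if s ≤ k then homogeneousComponent (k - s) else 0

theorem twistedComponent_mem {n k s : ℕ} (p : MvPolynomial (Fin n) ℂ) :
    twistedComponent n k s p ∈ twistedPiece n k s := by
  unfold twistedComponent twistedPiece
  split_ifs
  · exact homogeneousComponent_mem _ _
  · exact Submodule.zero_mem _

theorem twistedComponent_eq_self {n k s : ℕ} {p : MvPolynomial (Fin n) ℂ}
    (hp : p ∈ twistedPiece n k s) : twistedComponent n k s p = p := by
  unfold twistedComponent
  unfold twistedPiece at hp
  split_ifs at hp ⊢
  · exact homogeneousComponent_eq_self hp
  · exact ((Submodule.mem_bot ℂ).1 hp).symm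

theorem twistedComponent_mul {n k s t m : ℕ} (p : MvPolynomial (Fin n) ℂ)
    {h : MvPolynomial (Fin n) ℂ} (hh : h.IsHomogeneous m) (hst : s + m = t) :
    twistedComponent n k s (p * h) = twistedComponent n k t p * h := by
  unfold twistedComponent
  by_cases ht : t ≤ k
  · rw [if_pos (by omega), if_pos ht, homogeneousComponent_mul_of_le p hh (by omega)]
    congr 3
    omega
  · rw [if_neg ht, LinearMap.zero_apply, zero_mul]
    split_ifs
    · exact homogeneousComponent_mul_of_not_le p hh (by omega)
    · rfl

instance finiteDimensional_twistedPiece (n k s : ℕ) : Module.Finite ℂ (twistedPiece n k s) := by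
  by_cases h : s ≤ k
  · rw [twistedPiece, if_pos h]
    exact finiteDimensional_homogeneousSubmodule _ _
  · rw [twistedPiece, if_neg h]
    exact inferInstance

/-- The piece of degree `k` of the graded free module `⨁ S(-s i)`. -/
noncomputable def freePiece (n k : ℕ) {r : ℕ} (s : Fin r → ℕ) :
    Submodule ℂ (Fin r → MvPolynomial (Fin n) ℂ) :=
  Submodule.pi Set.univ fun i => twistedPiece n k (s i)

/-- The projection of `⨁ S(-s i)` to its piece of degree `k`. -/
noncomputable def freeComponent {n r : ℕ} (k : ℕ) (s : Fin r → ℕ)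
    (v : Fin r → MvPolynomial (Fin n) ℂ) : Fin r → MvPolynomial (Fin n) ℂ :=
  fun i => twistedComponent n k (s i) (v i)

theorem freeComponent_mem {n k r : ℕ} (s : Fin r → ℕ) (v : Fin r → MvPolynomial (Fin n) ℂ) :
    freeComponent k s v ∈ freePiece n k s :=
  fun _ _ => twistedComponent_mem _

theorem freeComponent_eq_self {n k r : ℕ} {s : Fin r → ℕ} {v : Fin r → MvPolynomial (Fin n) ℂ}
    (hv : v ∈ freePiece n k s) : freeComponent k s v = v :=
  funext fun i => twistedComponent_eq_self (hv i (Set.mem_univ i))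

instance finiteDimensional_freePiece (n k : ℕ) {r : ℕ} (s : Fin r → ℕ) :
    Module.Finite ℂ (freePiece n k s) :=
  Module.Finite.equiv (submodulePiEquiv fun i => twistedPiece n k (s i)).symm

theorem finrank_freePiece (n k : ℕ) {r : ℕ} (s : Fin r → ℕ) :
    Module.finrank ℂ (freePiece n k s) =
      ∑ j ∈ Finset.range (k + 1), (Finset.univ.filter fun i => s i = j).card *
        Module.finrank ℂ (twistedPiece n k j) := by
  rw [freePiece, finrank_submodule_pi]
  have h : ∀ i, Module.finrank ℂ (twistedPiece n k (s i)) =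
      ∑ j ∈ Finset.range (k + 1), if s i = j then Module.finrank ℂ (twistedPiece n k j) else 0 := by
    intro i
    rw [Finset.sum_ite_eq]
    split_ifs with hi
    · rfl
    · rw [twistedPiece, if_neg (by simpa using hi), finrank_bot]
  rw [Finset.sum_congr rfl fun i _ => h i, Finset.sum_comm]
  refine Finset.sum_congr rfl fun j _ => ?_
  rw [← Finset.sum_filter, Finset.sum_const, smul_eq_mul]

theorem linearMap_apply_eq_sum {n r : ℕ} {M : Type*} [AddCommGroup M]
    [Module (MvPolynomial (Fin n) ℂ) M]
    (φ : (Fin r → MvPolynomial (Fin n) ℂ) →ₗ[MvPolynomial (Fin n) ℂ] M)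
    (v : Fin r → MvPolynomial (Fin n) ℂ) : φ v = ∑ l, v l • φ (Pi.single l 1) := by
  conv_lhs => rw [pi_eq_sum_univ' v, map_sum]
  simp only [map_smul]

namespace MinimalGradedFreeResolution

variable {n : ℕ} {J : Ideal (MvPolynomial (Fin n) ℂ)} (F : MinimalGradedFreeResolution J)

theorem d_freeComponent (i k : ℕ) (v : Fin (F.rank (i + 1)) → MvPolynomial (Fin n) ℂ) :
    F.d i (freeComponent k (F.shift (i + 1)) v) = freeComponent k (F.shift i) (F.d i v) := by
  funext m
  rw [freeComponent, linearMap_apply_eq_sum, linearMap_apply_eq_sum (F.d i) v, Finset.sum_apply,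
    Finset.sum_apply, map_sum]
  refine Finset.sum_congr rfl fun l _ => ?_
  simp only [Pi.smul_apply, smul_eq_mul, freeComponent]
  by_cases h0 : F.d i (Pi.single l 1) m = 0
  · simp [h0]
  · obtain ⟨t, ht, hhom⟩ := F.d_graded i l m h0
    exact (twistedComponent_mul _ hhom ht).symm

/-- Exactness of the resolution in degree `k`. -/
theorem freePiece_inf_ker_d (i k : ℕ) :
    freePiece n k (F.shift (i + 1)) ⊓ ((F.d i).restrictScalars ℂ).ker =
      (freePiece n k (F.shift (i + 2))).map ((F.d (i + 1)).restrictScalars ℂ) := by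
  ext v
  constructor
  · rintro ⟨hv, h0⟩
    obtain ⟨u, rfl⟩ := (F.exact_d i v).1 h0
    refine ⟨freeComponent k _ u, freeComponent_mem _ _, ?_⟩
    exact (F.d_freeComponent _ _ _).trans (freeComponent_eq_self hv)
  · rintro ⟨u, hu, rfl⟩
    refine ⟨?_, (F.exact_d i _).2 ⟨u, rfl⟩⟩
    have := freeComponent_mem (k := k) (F.shift (i + 1)) (F.d (i + 1) u)
    rwa [← F.d_freeComponent, freeComponent_eq_self hu] at this

theorem freePiece_inf_ker_aug (k : ℕ) :
    freePiece n k (F.shift 0) ⊓ (F.aug.restrictScalars ℂ).ker =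
      (freePiece n k (F.shift 1)).map ((F.d 0).restrictScalars ℂ) := by
  ext v
  constructor
  · rintro ⟨hv, h0⟩
    obtain ⟨u, rfl⟩ := (F.exact_aug v).1 h0
    refine ⟨freeComponent k _ u, freeComponent_mem _ _, ?_⟩
    exact (F.d_freeComponent _ _ _).trans (freeComponent_eq_self hv)
  · rintro ⟨u, hu, rfl⟩
    refine ⟨?_, (F.exact_aug _).2 ⟨u, rfl⟩⟩
    have := freeComponent_mem (k := k) (F.shift 0) (F.d 0 u)
    rwa [← F.d_freeComponent, freeComponent_eq_self hu] at this

/-- For homogeneous `J` the augmentation maps the piece of degree `k` of `F 0` onto that of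
`S / J`. -/
theorem map_aug_freePiece (hJ : ∀ p ∈ J, ∀ k, homogeneousComponent k p ∈ J) (k : ℕ) :
    (freePiece n k (F.shift 0)).map (F.aug.restrictScalars ℂ) =
      (homogeneousSubmodule (Fin n) ℂ k).map (Ideal.Quotient.mkₐ ℂ J).toLinearMap := by
  choose p hp hpaug using F.aug_graded
  have haug : ∀ v, F.aug v = Ideal.Quotient.mk J (∑ l, v l * p l) := by
    intro v
    rw [linearMap_apply_eq_sum, map_sum]
    refine Finset.sum_congr rfl fun l _ => ?_
    rw [hpaug, map_mul]
    rfl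
  have hcomp : ∀ v : Fin (F.rank 0) → MvPolynomial (Fin n) ℂ,
      ∑ l, freeComponent k (F.shift 0) v l * p l = homogeneousComponent k (∑ l, v l * p l) := by
    intro v
    rw [map_sum]
    refine Finset.sum_congr rfl fun l _ => ?_
    rw [freeComponent, ← twistedComponent_mul _ (hp l) (zero_add _), twistedComponent,
      if_pos (Nat.zero_le k), Nat.sub_zero]
  ext x
  constructor
  · rintro ⟨v, hv, rfl⟩
    refine ⟨∑ l, v l * p l, ?_, (haug v).symm⟩
    have h := hcomp v
    rw [freeComponent_eq_self hv] at h
    rw [h]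
    exact homogeneousComponent_mem _ _
  · rintro ⟨q, hq, rfl⟩
    obtain ⟨v, hv⟩ := F.aug_surjective (Ideal.Quotient.mk J q)
    refine ⟨freeComponent k _ v, freeComponent_mem _ _, ?_⟩
    change F.aug _ = Ideal.Quotient.mk J q
    rw [haug, hcomp, Ideal.Quotient.eq]
    rw [haug, Ideal.Quotient.eq] at hv
    have := hJ _ hv k
    rwa [map_sub, homogeneousComponent_eq_self hq] at this

/-- In a minimal resolution the degrees of the generators increase at every step. -/
theorem le_shift (i : ℕ) : ∀ l, i ≤ F.shift i l := by
  induction i with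
  | zero => exact fun l => Nat.zero_le _
  | succ i ih =>
    intro l
    have hne : F.d i (Pi.single l 1) ≠ 0 := by
      intro h0
      obtain ⟨u, hu⟩ := (F.exact_d i _).1 h0
      have := F.minimal (i + 1) u l
      rw [hu, Pi.single_eq_same, map_one] at this
      exact one_ne_zero this
    obtain ⟨m, hm⟩ := Function.ne_iff.1 hne
    obtain ⟨t, ht, hhom⟩ := F.d_graded i l m hm
    have ht0 : t ≠ 0 := by
      rintro rfl
      have h1 := IsHomogeneous.eq_C_constantCoeff hhom
      rw [F.minimal, C_0] at h1
      exact hm h1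
    have := ih m
    omega

theorem freePiece_eq_bot {i k : ℕ} (hik : k < i) : freePiece n k (F.shift i) = ⊥ := by
  rw [eq_bot_iff]
  intro v hv
  rw [Submodule.mem_bot]
  funext l
  have h := hv l (Set.mem_univ l)
  have hl : ¬ F.shift i l ≤ k := fun hle => absurd (F.le_shift i l) (by omega)
  have h' : v l ∈ twistedPiece n k (F.shift i l) := h
  rwa [twistedPiece, if_neg hl, Submodule.mem_bot] at h'

/-- The dimensions in degree `k` of `S / J` and of the syzygy modules: `dim (F i)_k` is the sum of
the terms number `i` and `i + 1`. -/
theorem exists_syzygy_dimensions (hJ : ∀ p ∈ J, ∀ k, homogeneousComponent k p ∈ J) (k : ℕ) :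
    ∃ h : ℕ → ℕ, h 0 = hilbertFunction J k ∧ (∀ i, k < i → h i = 0) ∧
      ∀ i, h i + h (i + 1) = Module.finrank ℂ (freePiece n k (F.shift i)) := by
  refine ⟨fun i => Nat.casesOn i (hilbertFunction J k) fun i => Module.finrank ℂ
    ((freePiece n k (F.shift (i + 1))).map ((F.d i).restrictScalars ℂ)), rfl, ?_, ?_⟩
  · rintro (_ | i) hi
    · omega
    · dsimp only
      rw [F.freePiece_eq_bot hi, Submodule.map_bot, finrank_bot]
  · rintro (_ | i)
    · dsimp only
      rw [← F.freePiece_inf_ker_aug, hilbertFunction, ← F.map_aug_freePiece hJ]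
      exact finrank_map_add_finrank_inf_ker _ _
    · dsimp only
      rw [← F.freePiece_inf_ker_d]
      exact finrank_map_add_finrank_inf_ker _ _

end MinimalGradedFreeResolution

theorem homogeneousComponent_mem_span {n : ℕ} {ι : Type*} [Fintype ι]
    {h : ι → MvPolynomial (Fin n) ℂ} {d : ι → ℕ} (hh : ∀ i, (h i).IsHomogeneous (d i)) :
    ∀ p ∈ Ideal.span (Set.range h), ∀ k, homogeneousComponent k p ∈ Ideal.span (Set.range h) := by
  intro p hp k
  obtain ⟨c, rfl⟩ := Ideal.mem_span_range_iff_exists_fun.1 hp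
  rw [map_sum]
  refine Ideal.sum_mem _ fun i _ => ?_
  by_cases hi : d i ≤ k
  · rw [homogeneousComponent_mul_of_le _ (hh i) hi]
    exact Ideal.mul_mem_left _ _ (Ideal.subset_span ⟨i, rfl⟩)
  · rw [homogeneousComponent_mul_of_not_le _ (hh i) hi]
    exact Ideal.zero_mem _

/-- Jacobian algebras with the same graded Betti numbers have the same Hilbert function. -/
theorem hilbertFunction_eq_of_isJacobianBetti {n d d' : ℕ} {f f' : MvPolynomial (Fin n) ℂ}
    (hf : f.IsHomogeneous d) (hf' : f'.IsHomogeneous d') {β : ℕ → ℕ → ℕ}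
    (h : IsJacobianBetti f β) (h' : IsJacobianBetti f' β) (k : ℕ) :
    hilbertFunction (jacobianIdeal f) k = hilbertFunction (jacobianIdeal f') k := by
  obtain ⟨F, rfl⟩ := h
  obtain ⟨F', hF'⟩ := h'
  obtain ⟨a, ha0, hak, ha⟩ := F.exists_syzygy_dimensions
    (homogeneousComponent_mem_span (d := fun _ => d - 1) fun i => hf.pderiv) k
  obtain ⟨b, hb0, hbk, hb⟩ := F'.exists_syzygy_dimensions
    (homogeneousComponent_mem_span (d := fun _ => d' - 1) fun i => hf'.pderiv) k
  have hab : ∀ i, a i + a (i + 1) = b i + b (i + 1) := by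
    intro i
    rw [ha, hb, finrank_freePiece, finrank_freePiece]
    exact Finset.sum_congr rfl fun j _ => congrArg (· * _) (congrFun (congrFun hF' i) j).symm
  have key : ∀ t, a (k + 1 - t) = b (k + 1 - t) := by
    intro t
    induction t with
    | zero => rw [hak _ (by omega), hbk _ (by omega)]
    | succ t ih =>
      by_cases ht : t < k + 1
      · have := hab (k + 1 - (t + 1))
        rw [show k + 1 - (t + 1) + 1 = k + 1 - t by omega] at this
        omega
      · rwa [show k + 1 - (t + 1) = k + 1 - t by omega]
  have := key (k + 1)
  rw [Nat.sub_self] at this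
  rw [← ha0, ← hb0, this]

/-! ### Semicontinuity of the Hilbert function -/

theorem idealPiece_jacobianIdeal_eq_bot {n d k : ℕ} {f : MvPolynomial (Fin n) ℂ}
    (hf : f.IsHomogeneous d) (hk : ¬ d - 1 ≤ k) : idealPiece (jacobianIdeal f) k = ⊥ := by
  rw [eq_bot_iff]
  rintro p ⟨hp, hmem⟩
  obtain ⟨a, -, ha, hsum⟩ := exists_isHomogeneous_of_mem_span (e := fun _ => d - 1)
    (fun i => hf.pderiv) hp hmem
  rw [Submodule.mem_bot, hsum]
  exact Finset.sum_eq_zero fun i _ => by rw [ha i hk, zero_mul]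

/-- The products of the partial derivatives of `f` with the monomials of degree `e`. -/
noncomputable def jacobianGenerator {n : ℕ} (e : ℕ) (f : MvPolynomial (Fin n) ℂ)
    (x : Fin n × Exponents n e) : MvPolynomial (Fin n) ℂ :=
  monomial x.2.1 1 * pderiv x.1 f

theorem jacobianGenerator_mem {n d k : ℕ} {f : MvPolynomial (Fin n) ℂ}
    (hf : f.IsHomogeneous d) (hk : d - 1 ≤ k) (x : Fin n × Exponents n (k - (d - 1))) :
    jacobianGenerator _ f x ∈ idealPiece (jacobianIdeal f) k := by
  refine ⟨?_, Ideal.mul_mem_left _ _ (pderiv_mem_jacobianIdeal f x.1)⟩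
  have h1 := (isHomogeneous_monomial (1 : ℂ) (mem_finsuppAntidiag_univ_iff.1 x.2.2)).mul
    (hf.pderiv (i := x.1))
  rwa [Nat.sub_add_cancel hk] at h1

theorem span_jacobianGenerator {n d k : ℕ} {f : MvPolynomial (Fin n) ℂ}
    (hf : f.IsHomogeneous d) (hk : d - 1 ≤ k) :
    Submodule.span ℂ (Set.range (jacobianGenerator (k - (d - 1)) f)) =
      idealPiece (jacobianIdeal f) k := by
  refine le_antisymm (Submodule.span_le.2 ?_) ?_
  · rintro _ ⟨x, rfl⟩
    exact jacobianGenerator_mem hf hk x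
  · rintro p ⟨hp, hmem⟩
    obtain ⟨a, ha, -, hsum⟩ := exists_isHomogeneous_of_mem_span (e := fun _ => d - 1)
      (fun i => hf.pderiv) hp hmem
    rw [hsum]
    refine Submodule.sum_mem _ fun i _ => ?_
    rw [sum_monomial_coeff_of_isHomogeneous (ha i), Finset.sum_mul]
    refine Submodule.sum_mem _ fun m _ => ?_
    rw [smul_mul_assoc]
    exact Submodule.smul_mem _ _ (Submodule.subset_span ⟨(i, m), rfl⟩)

theorem continuousOn_coeffVector_jacobianGenerator {n : ℕ} {F : ℝ → MvPolynomial (Fin n) ℂ}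
    {s : Set ℝ} (hF : ∀ m, ContinuousOn (fun t => coeff m (F t)) s) (k e : ℕ)
    (x : Fin n × Exponents n e) :
    ContinuousOn (fun t => coeffVector n k (jacobianGenerator e (F t) x)) s := by
  refine continuousOn_pi.2 fun m => ?_
  simp only [coeffVector, jacobianGenerator, LinearMap.coe_mk, AddHom.coe_mk, coeff_monomial_mul',
    coeff_pderiv]
  split_ifs
  · exact continuousOn_const.mul ((hF _).mul continuousOn_const)
  · exact continuousOn_const

/-- The Hilbert function of the Jacobian algebra cannot drop under specialization: in each degree
its value at `t = 0` is at least its value at some (in fact, every) small `t > 0`. -/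
theorem exists_hilbertFunction_le {n d : ℕ} {F : ℝ → MvPolynomial (Fin n) ℂ} {t₀ : ℝ}
    (ht₀ : 0 < t₀) (hF : ∀ m, ContinuousOn (fun t => coeff m (F t)) (Set.Icc 0 t₀))
    (hhom : ∀ t ∈ Set.Icc 0 t₀, (F t).IsHomogeneous d) (k : ℕ) :
    ∃ t ∈ Set.Ioc 0 t₀,
      hilbertFunction (jacobianIdeal (F t)) k ≤ hilbertFunction (jacobianIdeal (F 0)) k := by
  suffices h : ∃ t ∈ Set.Ioc 0 t₀, Module.finrank ℂ (idealPiece (jacobianIdeal (F 0)) k) ≤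
      Module.finrank ℂ (idealPiece (jacobianIdeal (F t)) k) by
    obtain ⟨t, ht, hle⟩ := h
    have h1 := hilbertFunction_add_finrank_idealPiece (jacobianIdeal (F 0)) k
    have h2 := hilbertFunction_add_finrank_idealPiece (jacobianIdeal (F t)) k
    exact ⟨t, ht, by omega⟩
  have h0mem : (0 : ℝ) ∈ Set.Icc 0 t₀ := ⟨le_rfl, ht₀.le⟩
  by_cases hk : d - 1 ≤ k
  swap
  · exact ⟨t₀, ⟨ht₀, le_rfl⟩, by
      rw [idealPiece_jacobianIdeal_eq_bot (hhom 0 h0mem) hk, finrank_bot]; exact Nat.zero_le _⟩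
  set e := k - (d - 1) with he
  obtain ⟨κ, a, ha, hspan, hli⟩ := exists_linearIndependent' ℂ (jacobianGenerator e (F 0))
  have hfin : Finite κ := Finite.of_injective a ha
  have := Fintype.ofFinite κ
  rw [span_jacobianGenerator (hhom 0 h0mem) hk] at hspan
  have hli0 : LinearIndependent ℂ fun i => coeffVector n k (jacobianGenerator e (F 0) (a i)) := by
    refine hli.map (f := coeffVector n k) ?_
    rw [hspan, Submodule.disjoint_def]
    exact fun p hp h0 => eq_zero_of_coeffVector_eq_zero hp.1 h0
  have hcont : ContinuousWithinAt
      (fun t i => coeffVector n k (jacobianGenerator e (F t) (a i))) (Set.Icc 0 t₀) 0 :=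
    continuousWithinAt_pi.2 fun i =>
      continuousOn_coeffVector_jacobianGenerator hF k e (a i) 0 h0mem
  have hev := hcont.eventually (isOpen_setOfPred_linearIndependent.mem_nhds hli0)
  have hev' := hev.filter_mono (nhdsWithin_mono 0 Set.Ioc_subset_Icc_self)
  have hne : (nhdsWithin (0 : ℝ) (Set.Ioc 0 t₀)).NeBot := by
    rw [nhdsWithin_Ioc_eq_nhdsGT ht₀]; infer_instance
  obtain ⟨t, hlit, ht⟩ := (hev'.and self_mem_nhdsWithin).exists
  refine ⟨t, ht, ?_⟩
  have hlit' : LinearIndependent ℂ fun i => jacobianGenerator e (F t) (a i) :=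
    LinearIndependent.of_comp (coeffVector n k) hlit
  rw [← hspan, finrank_span_eq_card hli, ← finrank_span_eq_card hlit']
  refine Submodule.finrank_mono (Submodule.span_le.2 ?_)
  rintro _ ⟨i, rfl⟩
  exact jacobianGenerator_mem (hhom t (Set.Ioc_subset_Icc_self ht)) hk _

/-! ### Hyperplanes and flats -/

/-- The hyperplane `ℓ = 0` for a linear form `ℓ`. -/
noncomputable def hyperplane {n : ℕ} (ℓ : MvPolynomial (Fin n) ℂ) : Submodule ℂ (Fin n → ℂ) :=
  LinearMap.ker (linearFunctional ℓ)

theorem mem_hyperplane {n : ℕ} {ℓ : MvPolynomial (Fin n) ℂ} (h : ℓ.IsHomogeneous 1)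
    {v : Fin n → ℂ} : v ∈ hyperplane ℓ ↔ eval v ℓ = 0 := by
  rw [hyperplane, LinearMap.mem_ker, eval_eq_linearFunctional h]

theorem isCoatom_hyperplane {n : ℕ} {ℓ : MvPolynomial (Fin n) ℂ} (h : ℓ.IsHomogeneous 1)
    (h0 : ℓ ≠ 0) : IsCoatom (hyperplane ℓ) :=
  LinearMap.isCoatom_ker_of_surjective
    (LinearMap.surjective fun hz => h0 (linearFunctional_eq_zero h hz))

theorem IsReducedFamily.hyperplane_injective {n : ℕ} {ι : Type*}
    {ℓ : ι → MvPolynomial (Fin n) ℂ} (h : IsReducedFamily ℓ) :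
    Function.Injective fun i => hyperplane (ℓ i) := by
  intro i j hij
  by_contra hne
  dsimp only [hyperplane] at hij
  have h1 : linearFunctional (ℓ i) ∈
      Submodule.span ℂ (Set.range fun _ : Unit => linearFunctional (ℓ j)) :=
    mem_span_of_iInf_ker_le_ker (by rw [iInf_const, hij])
  rw [Set.range_const, Submodule.mem_span_singleton] at h1
  obtain ⟨a, ha⟩ := h1
  have h2 : (ℓ i - a • ℓ j).IsHomogeneous 1 :=
    (h.1 i).1.sub ((homogeneousSubmodule _ _ 1).smul_mem a (h.1 j).1)
  have := linearFunctional_eq_zero h2 (by rw [map_sub, map_smul, ha, sub_self])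
  exact h.2 i j hne a (sub_eq_zero.1 this)

theorem IsReducedFamily.arrangementHyperplanes_eq {n : ℕ} {ι : Type*} [Fintype ι]
    {ℓ : ι → MvPolynomial (Fin n) ℂ} (h : IsReducedFamily ℓ) {c : ℂ} (hc : c ≠ 0) :
    arrangementHyperplanes (C c * formProduct ℓ Finset.univ) =
      Set.range fun i => hyperplane (ℓ i) := by
  have heval : ∀ v, eval v (C c * formProduct ℓ Finset.univ) = 0 ↔ ∃ i, v ∈ hyperplane (ℓ i) := by
    intro v
    rw [map_mul, eval_C, mul_eq_zero, or_iff_right hc, eval_formProduct_eq_zero]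
    simp [mem_hyperplane (h.1 _).1]
  ext H
  constructor
  · rintro ⟨hH, hzero⟩
    have hcover : ⋃ i, (((hyperplane (ℓ i)).comap H.subtype : Submodule ℂ H) : Set H) =
        Set.univ := by
      refine Set.eq_univ_of_forall fun v => ?_
      obtain ⟨i, hi⟩ := (heval v.1).1 (hzero v.1 v.2)
      exact Set.mem_iUnion.2 ⟨i, hi⟩
    obtain ⟨i, hi⟩ := Subspace.exists_eq_top_of_iUnion_eq_univ hcover
    rw [Submodule.comap_subtype_eq_top] at hi
    exact ⟨i, (hH.le_iff_eq (isCoatom_hyperplane (h.1 i).1 (h.1 i).2).1).1 hi⟩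
  · rintro ⟨i, rfl⟩
    exact ⟨isCoatom_hyperplane (h.1 i).1 (h.1 i).2, fun v hv => (heval v).2 ⟨i, hv⟩⟩

theorem IsArrangementEquation.exists_family {n : ℕ} {g : MvPolynomial (Fin n) ℂ}
    (hg : IsArrangementEquation g) :
    ∃ (e : ℕ) (ℓ : Fin e → MvPolynomial (Fin n) ℂ) (c : ℂ), c ≠ 0 ∧ IsReducedFamily ℓ ∧
      g = C c * formProduct ℓ Finset.univ := by
  obtain ⟨e, ℓ, c, hc, h1, h2, rfl⟩ := hg
  exact ⟨e, ℓ, c, hc, ⟨h1, h2⟩, rfl⟩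

theorem sameLattice_iff {n : ℕ} {g : MvPolynomial (Fin n) ℂ} {g' : MvPolynomial (Fin n) ℂ} :
    SameLattice g g' ↔ Nonempty (arrangementFlats g ≃o arrangementFlats g') :=
  ⟨fun ⟨e⟩ => ⟨e.dual⟩, fun ⟨e⟩ => ⟨e.dual⟩⟩

instance arrangementFlats.orderTop {n : ℕ} (g : MvPolynomial (Fin n) ℂ) :
    OrderTop (arrangementFlats g) where
  top := ⟨⊤, ∅, Set.empty_subset _, sInf_empty.symm⟩
  le_top X := le_top (a := X.1)

theorem arrangementFlats.isCoatom_iff {n : ℕ} {g : MvPolynomial (Fin n) ℂ}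
    {X : arrangementFlats g} : IsCoatom X ↔ X.1 ∈ arrangementHyperplanes g := by
  have hflat : ∀ H ∈ arrangementHyperplanes g, H ∈ arrangementFlats g := fun H hH =>
    ⟨{H}, Set.singleton_subset_iff.2 hH, sInf_singleton.symm⟩
  constructor
  · rintro ⟨hne, hmax⟩
    obtain ⟨s, hs, hX⟩ := X.2
    obtain ⟨H, hH⟩ : s.Nonempty := by
      rw [Set.nonempty_iff_ne_empty]
      rintro rfl
      exact hne (Subtype.ext (hX.trans sInf_empty))
    have hle : X ≤ ⟨H, hflat H (hs hH)⟩ := show X.1 ≤ H from hX ▸ sInf_le hH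
    rcases hle.eq_or_lt with heq | hlt
    · exact heq ▸ hs hH
    · exact absurd (congrArg Subtype.val (hmax _ hlt)) (hs hH).1.1
  · intro hX
    exact ⟨fun h => hX.1.1 (congrArg Subtype.val h), fun Y hY => Subtype.ext (hX.1.2 Y.1 hY)⟩

theorem inf_mem_arrangementFlats {n : ℕ} {g : MvPolynomial (Fin n) ℂ}
    {H K : Submodule ℂ (Fin n → ℂ)} (hH : H ∈ arrangementHyperplanes g)
    (hK : K ∈ arrangementHyperplanes g) : H ⊓ K ∈ arrangementFlats g :=
  ⟨{H, K}, Set.insert_subset hH (Set.singleton_subset_iff.2 hK), sInf_pair.symm⟩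

/-- An isomorphism of intersection lattices is induced by a bijection between the hyperplanes that
preserves the relation `Hᵢ ∩ Hⱼ ⊆ Hₖ`. -/
theorem exists_equiv_of_sameLattice {n : ℕ} {ι ι' : Type*} [Fintype ι] [Fintype ι']
    {ℓ : ι → MvPolynomial (Fin n) ℂ} {ℓ' : ι' → MvPolynomial (Fin n) ℂ} (h : IsReducedFamily ℓ)
    (h' : IsReducedFamily ℓ') {c c' : ℂ} (hc : c ≠ 0) (hc' : c' ≠ 0)
    (hL : SameLattice (C c * formProduct ℓ Finset.univ) (C c' * formProduct ℓ' Finset.univ)) :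
    ∃ σ : ι ≃ ι', ∀ i j k, hyperplane (ℓ i) ⊓ hyperplane (ℓ j) ≤ hyperplane (ℓ k) ↔
      hyperplane (ℓ' (σ i)) ⊓ hyperplane (ℓ' (σ j)) ≤ hyperplane (ℓ' (σ k)) := by
  obtain ⟨E⟩ := sameLattice_iff.1 hL
  set g := C c * formProduct ℓ Finset.univ
  set g' := C c' * formProduct ℓ' Finset.univ
  have hH : arrangementHyperplanes g = _ := h.arrangementHyperplanes_eq hc
  have hH' : arrangementHyperplanes g' = _ := h'.arrangementHyperplanes_eq hc'
  have hmem : ∀ i, hyperplane (ℓ i) ∈ arrangementHyperplanes g := fun i => hH ▸ ⟨i, rfl⟩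
  have hmem' : ∀ i, hyperplane (ℓ' i) ∈ arrangementHyperplanes g' := fun i => hH' ▸ ⟨i, rfl⟩
  let A : ι → arrangementFlats g := fun i =>
    ⟨hyperplane (ℓ i), {hyperplane (ℓ i)}, Set.singleton_subset_iff.2 (hmem i),
      sInf_singleton.symm⟩
  let A' : ι' → arrangementFlats g' := fun i =>
    ⟨hyperplane (ℓ' i), {hyperplane (ℓ' i)}, Set.singleton_subset_iff.2 (hmem' i),
      sInf_singleton.symm⟩
  have hA : ∀ X, IsCoatom X ↔ ∃ i, A i = X := fun X => by
    rw [arrangementFlats.isCoatom_iff, hH]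
    exact exists_congr fun i => ⟨fun hi => Subtype.ext hi, fun hi => congrArg Subtype.val hi⟩
  have hA' : ∀ X, IsCoatom X ↔ ∃ i, A' i = X := fun X => by
    rw [arrangementFlats.isCoatom_iff, hH']
    exact exists_congr fun i => ⟨fun hi => Subtype.ext hi, fun hi => congrArg Subtype.val hi⟩
  have hinj : Function.Injective A := fun i j hij =>
    h.hyperplane_injective (congrArg Subtype.val hij)
  have hinj' : Function.Injective A' := fun i j hij =>
    h'.hyperplane_injective (congrArg Subtype.val hij)
  have hex : ∀ i, ∃ j, A' j = E (A i) := fun i =>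
    (hA' _).1 ((OrderIso.isCoatom_iff E _).2 ((hA _).2 ⟨i, rfl⟩))
  choose σ hσ using hex
  have hbij : Function.Bijective σ := by
    constructor
    · intro i j hij
      exact hinj (E.injective (by rw [← hσ, ← hσ, hij]))
    · intro j
      obtain ⟨i, hi⟩ := (hA _).1 ((OrderIso.isCoatom_iff E.symm _).2 ((hA' _).2 ⟨j, rfl⟩))
      exact ⟨i, hinj' (by rw [hσ, hi, E.apply_symm_apply])⟩
  refine ⟨Equiv.ofBijective σ hbij, fun i j k => ?_⟩
  have key : ∀ i j k, hyperplane (ℓ i) ⊓ hyperplane (ℓ j) ≤ hyperplane (ℓ k) ↔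
      ∀ X, X ≤ A i → X ≤ A j → X ≤ A k := fun i j k =>
    ⟨fun hle X hi hj => (le_inf hi hj : X.1 ≤ _).trans hle, fun hX =>
      hX ⟨_, inf_mem_arrangementFlats (hmem i) (hmem j)⟩
        (inf_le_left : hyperplane (ℓ i) ⊓ hyperplane (ℓ j) ≤ _)
        (inf_le_right : hyperplane (ℓ i) ⊓ hyperplane (ℓ j) ≤ _)⟩
  have key' : ∀ i j k, hyperplane (ℓ' i) ⊓ hyperplane (ℓ' j) ≤ hyperplane (ℓ' k) ↔
      ∀ X, X ≤ A' i → X ≤ A' j → X ≤ A' k := fun i j k =>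
    ⟨fun hle X hi hj => (le_inf hi hj : X.1 ≤ _).trans hle, fun hX =>
      hX ⟨_, inf_mem_arrangementFlats (hmem' i) (hmem' j)⟩
        (inf_le_left : hyperplane (ℓ' i) ⊓ hyperplane (ℓ' j) ≤ _)
        (inf_le_right : hyperplane (ℓ' i) ⊓ hyperplane (ℓ' j) ≤ _)⟩
  rw [key, Equiv.ofBijective_apply, Equiv.ofBijective_apply, Equiv.ofBijective_apply, key',
    hσ, hσ, hσ, E.surjective.forall (p := fun X => X ≤ E (A i) → X ≤ E (A j) → X ≤ E (A k))]
  simp only [E.le_iff_le]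

/-- The Tjurina number of a line arrangement is determined by the incidences of its lines. -/
theorem tjurinaNumber_eq_of_equiv {n : ℕ} {ι ι' : Type*} [Fintype ι] [Fintype ι']
    {ℓ : ι → MvPolynomial (Fin n) ℂ} {ℓ' : ι' → MvPolynomial (Fin n) ℂ} (h : IsReducedFamily ℓ)
    (h' : IsReducedFamily ℓ') (σ : ι ≃ ι')
    (hσ : ∀ i j k, hyperplane (ℓ i) ⊓ hyperplane (ℓ j) ≤ hyperplane (ℓ k) ↔
      hyperplane (ℓ' (σ i)) ⊓ hyperplane (ℓ' (σ j)) ≤ hyperplane (ℓ' (σ k))) :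
    tjurinaNumber ℓ = tjurinaNumber ℓ' := by
  classical
  have hmem : ∀ i j k, k ∈ linesThrough ℓ i j ↔
      hyperplane (ℓ i) ⊓ hyperplane (ℓ j) ≤ hyperplane (ℓ k) := by
    intro i j k
    simp only [linesThrough, Finset.mem_filter_univ, SetLike.le_def, Submodule.mem_inf,
      mem_hyperplane (h.1 _).1, and_imp]
  have hmem' : ∀ i j k, k ∈ linesThrough ℓ' i j ↔
      hyperplane (ℓ' i) ⊓ hyperplane (ℓ' j) ≤ hyperplane (ℓ' k) := by
    intro i j k
    simp only [linesThrough, Finset.mem_filter_univ, SetLike.le_def, Submodule.mem_inf,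
      mem_hyperplane (h'.1 _).1, and_imp]
  have hlines : ∀ i j, linesThrough ℓ' (σ i) (σ j) = (linesThrough ℓ i j).map σ.toEmbedding := by
    intro i j
    ext k
    obtain ⟨k, rfl⟩ := σ.surjective k
    rw [hmem', ← hσ, ← hmem]
    exact (Finset.mem_map' σ.toEmbedding).symm
  have hpoints : multiplePoints ℓ' =
      (multiplePoints ℓ).map (Finset.mapEmbedding σ.toEmbedding).toEmbedding := by
    ext p
    simp only [multiplePoints, Finset.mem_image, Finset.mem_map, Finset.mem_filter_univ,
      Prod.exists]
    constructor
    · rintro ⟨i, j, hij, rfl⟩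
      obtain ⟨i, rfl⟩ := σ.surjective i
      obtain ⟨j, rfl⟩ := σ.surjective j
      exact ⟨_, ⟨i, j, fun hij' => hij (congrArg σ hij'), rfl⟩, (hlines i j).symm⟩
    · rintro ⟨_, ⟨i, j, hij, rfl⟩, rfl⟩
      exact ⟨σ i, σ j, σ.injective.ne hij, hlines i j⟩
  rw [tjurinaNumber, tjurinaNumber, hpoints, Finset.sum_map]
  refine Finset.sum_congr rfl fun p _ => ?_
  change _ = ((p.map σ.toEmbedding).card - 1) ^ 2
  rw [Finset.card_map]

/-! ### The intersection lattice of a cone -/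

/-- The linear forms of the cone: the new variable `w` and the forms of the arrangement. -/
noncomputable def coneFamily {n : ℕ} {ι : Type*} (ℓ : ι → MvPolynomial (Fin n) ℂ) :
    Option ι → MvPolynomial (Fin (n + 1)) ℂ :=
  fun o => o.elim (X (Fin.last n)) fun i => rename Fin.castSucc (ℓ i)

theorem coneEquation_eq {n : ℕ} {ι : Type*} [Fintype ι] (ℓ : ι → MvPolynomial (Fin n) ℂ) (c : ℂ) :
    coneEquation (C c * formProduct ℓ Finset.univ) =
      C c * formProduct (coneFamily ℓ) Finset.univ := by
  rw [coneEquation, formProduct, formProduct, Fintype.prod_option, map_mul, rename_C, map_prod,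
    mul_left_comm]
  rfl

theorem eval_snoc_rename {n : ℕ} (p : MvPolynomial (Fin n) ℂ) (x : Fin n → ℂ) (a : ℂ) :
    eval (Fin.snoc x a : Fin (n + 1) → ℂ) (rename Fin.castSucc p) = eval x p := by
  rw [eval_rename]
  congr 2
  funext i
  simp

theorem IsReducedFamily.coneFamily {n : ℕ} {ι : Type*} {ℓ : ι → MvPolynomial (Fin n) ℂ}
    (h : IsReducedFamily ℓ) : IsReducedFamily (coneFamily ℓ) := by
  constructor
  · rintro (_ | i)
    · exact ⟨isHomogeneous_X _ _, X_ne_zero _⟩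
    · exact ⟨(h.1 i).1.rename_isHomogeneous, fun h0 => (h.1 i).2
        (rename_injective _ (Fin.castSucc_injective n) (by rw [map_zero]; exact h0))⟩
  · rintro (_ | i) (_ | j) hij a heq
    · exact hij rfl
    · have h1 := congrArg (eval (Fin.snoc 0 1 : Fin (n + 1) → ℂ)) heq
      have h2 : eval (0 : Fin n → ℂ) (ℓ j) = 0 := by
        rw [eval_eq_linearFunctional (h.1 j).1, map_zero]
      simp only [_root_.coneFamily, Option.elim_none, Option.elim_some, smul_eval, eval_snoc_rename,
        h2, eval_X, Fin.snoc_last, mul_zero, one_ne_zero] at h1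
    · refine (h.1 i).2 (MvPolynomial.funext fun x => ?_)
      have h1 := congrArg (eval (Fin.snoc x 0 : Fin (n + 1) → ℂ)) heq
      simpa [_root_.coneFamily, smul_eval, eval_snoc_rename] using h1
    · refine h.2 i j (fun hij' => hij (congrArg some hij')) a
        (rename_injective _ (Fin.castSucc_injective n) ?_)
      rw [map_smul]
      exact heq

/-- The projection `ℂⁿ⁺¹ → ℂⁿ` that forgets the last coordinate. -/
def forgetLast (n : ℕ) : (Fin (n + 1) → ℂ) →ₗ[ℂ] (Fin n → ℂ) :=
  LinearMap.funLeft ℂ ℂ Fin.castSucc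

/-- The hyperplane at infinity `w = 0`. -/
noncomputable def infinityHyperplane (n : ℕ) : Submodule ℂ (Fin (n + 1) → ℂ) :=
  LinearMap.ker (LinearMap.proj (Fin.last n))

theorem IsArrangementEquation.arrangementHyperplanes_coneEquation {n : ℕ}
    {g : MvPolynomial (Fin n) ℂ} (hg : IsArrangementEquation g) :
    arrangementHyperplanes (coneEquation g) = insert (infinityHyperplane n)
      ((Submodule.comap (forgetLast n)) '' arrangementHyperplanes g) := by
  obtain ⟨e, ℓ, c, hc, h, rfl⟩ := hg.exists_family
  have h1 : hyperplane (coneFamily ℓ none) = infinityHyperplane n := by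
    ext v
    rw [mem_hyperplane (h.coneFamily.1 none).1]
    simp [coneFamily, infinityHyperplane]
  have h2 : ∀ i, hyperplane (coneFamily ℓ (some i)) =
      (hyperplane (ℓ i)).comap (forgetLast n) := by
    intro i
    ext v
    rw [mem_hyperplane (h.coneFamily.1 (some i)).1, Submodule.mem_comap,
      mem_hyperplane (h.1 i).1]
    change eval v (rename Fin.castSucc (ℓ i)) = 0 ↔ _
    rw [eval_rename]
    rfl
  rw [coneEquation_eq, h.coneFamily.arrangementHyperplanes_eq hc, h.arrangementHyperplanes_eq hc,
    ← Set.range_comp]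
  ext H
  simp only [Set.mem_range, Option.exists, Set.mem_insert_iff, Function.comp_apply, h1, h2,
    eq_comm]

/-- The flat `X × ℂ` (if `b` holds) or `X × 0` of the cone. -/
noncomputable def coneFlat {n : ℕ} (X : Submodule ℂ (Fin n → ℂ)) (b : Bool) :
    Submodule ℂ (Fin (n + 1) → ℂ) :=
  X.comap (forgetLast n) ⊓ if b then ⊤ else infinityHyperplane n

theorem snoc_mem_coneFlat {n : ℕ} {X : Submodule ℂ (Fin n → ℂ)} {b : Bool} {x : Fin n → ℂ}
    {a : ℂ} : (Fin.snoc x a : Fin (n + 1) → ℂ) ∈ coneFlat X b ↔ x ∈ X ∧ (b = false → a = 0) := by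
  have h : forgetLast n (Fin.snoc x a : Fin (n + 1) → ℂ) = x := by
    funext i
    simp [forgetLast, LinearMap.funLeft_apply]
  cases b <;> simp [coneFlat, h, infinityHyperplane]

theorem coneFlat_le_coneFlat {n : ℕ} {X Y : Submodule ℂ (Fin n → ℂ)} {b c : Bool} :
    coneFlat X b ≤ coneFlat Y c ↔ X ≤ Y ∧ b ≤ c := by
  constructor
  · intro hle
    constructor
    · intro x hx
      exact (snoc_mem_coneFlat.1 (hle (snoc_mem_coneFlat.2 ⟨hx, fun _ => (rfl : (0 : ℂ) = 0)⟩))).1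
    · cases b
      · exact Bool.false_le _
      · cases c
        · have h1 := hle (snoc_mem_coneFlat.2 ⟨X.zero_mem, fun h => absurd h (by decide)⟩ :
            (Fin.snoc 0 1 : Fin (n + 1) → ℂ) ∈ coneFlat X true)
          exact absurd ((snoc_mem_coneFlat.1 h1).2 rfl) one_ne_zero
        · exact le_rfl
  · rintro ⟨hX, hb⟩
    refine inf_le_inf (Submodule.comap_mono hX) ?_
    revert hb
    cases b <;> cases c <;> simp

/-- The intersection lattice of the cone over `g` is the product of that of `g` with the chain of
length one. -/
theorem IsArrangementEquation.exists_orderIso_coneEquation {n : ℕ} {g : MvPolynomial (Fin n) ℂ}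
    (hg : IsArrangementEquation g) :
    Nonempty (arrangementFlats g × Bool ≃o arrangementFlats (coneEquation g)) := by
  classical
  have hH := hg.arrangementHyperplanes_coneEquation
  have hflat : ∀ X ∈ arrangementFlats g, ∀ b, coneFlat X b ∈ arrangementFlats (coneEquation g) := by
    rintro _ ⟨s, hs, rfl⟩ b
    refine ⟨(Submodule.comap (forgetLast n)) '' s ∪ if b then ∅ else {infinityHyperplane n},
      ?_, ?_⟩
    · rw [hH]
      refine Set.union_subset ((Set.image_mono hs).trans (Set.subset_insert _ _)) ?_
      split_ifs
      · exact Set.empty_subset _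
      · exact Set.singleton_subset_iff.2 (Set.mem_insert _ _)
    · rw [sInf_union, coneFlat]
      congr 1
      · ext v
        simp [Submodule.mem_sInf]
      · split_ifs <;> simp
  let Θ : arrangementFlats g × Bool → arrangementFlats (coneEquation g) := fun x =>
    ⟨coneFlat x.1 x.2, hflat _ x.1.2 _⟩
  have hle : ∀ x y, Θ x ≤ Θ y ↔ x ≤ y := fun x y => coneFlat_le_coneFlat
  have hsurj : Function.Surjective Θ := by
    rintro ⟨_, s, hs, rfl⟩
    refine ⟨⟨⟨sInf {H ∈ arrangementHyperplanes g | H.comap (forgetLast n) ∈ s}, _,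
      Set.sep_subset _ _, rfl⟩, decide (infinityHyperplane n ∉ s)⟩, Subtype.ext ?_⟩
    change coneFlat _ _ = sInf s
    refine le_antisymm (le_sInf fun K hK => ?_) (le_inf ?_ ?_)
    · have hK' := hs hK
      rw [hH] at hK'
      rcases hK' with rfl | ⟨H, hHmem, rfl⟩
      · refine inf_le_right.trans ?_
        simp [hK]
      · exact inf_le_left.trans (Submodule.comap_mono (sInf_le ⟨hHmem, hK⟩))
    · intro v hv
      rw [Submodule.mem_comap, Submodule.mem_sInf]
      rintro H ⟨-, hHs⟩
      exact Submodule.mem_sInf.1 hv _ hHs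
    · by_cases hinf : infinityHyperplane n ∈ s
      · simpa [hinf] using sInf_le hinf
      · simp [hinf]
  exact ⟨RelIso.ofSurjective (OrderEmbedding.ofMapLEIff Θ hle) hsurj⟩

theorem SameLattice.coneEquation {n : ℕ} {g g' : MvPolynomial (Fin n) ℂ}
    (hg : IsArrangementEquation g) (hg' : IsArrangementEquation g') (h : SameLattice g g') :
    SameLattice (coneEquation g) (coneEquation g') := by
  obtain ⟨E⟩ := sameLattice_iff.1 h
  obtain ⟨Φ⟩ := hg.exists_orderIso_coneEquation
  obtain ⟨Φ'⟩ := hg'.exists_orderIso_coneEquation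
  let P : arrangementFlats g × Bool ≃o arrangementFlats g' × Bool :=
    { toEquiv := Equiv.prodCongr E.toEquiv (Equiv.refl Bool)
      map_rel_iff' := fun {x y} => and_congr_left' E.le_iff_le }
  exact sameLattice_iff.2 ⟨(Φ.symm.trans P).trans Φ'⟩

/-! ### The Hilbert polynomial of a cone over a line arrangement -/

theorem jacobianHilbertFunction_eq {n : ℕ} (f : MvPolynomial (Fin n) ℂ) (k : ℕ) :
    jacobianHilbertFunction f k = hilbertFunction (jacobianIdeal f) k :=
  rfl

/-- The Hilbert polynomial of the Jacobian algebra of the cone over an arrangement of `e` lines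
with Tjurina number `τ`, where `a` is the sum of the values at `0, …, K - 1` of the Hilbert
function of the Jacobian algebra of the arrangement, which equals `τ` from `K` on. -/
noncomputable def coneHilbertPolynomial (e K τ a : ℕ) : Polynomial ℚ :=
  Polynomial.C (1 / 2) * ((Polynomial.X + 1) * (Polynomial.X + 2)) -
    Polynomial.C (1 / 2) * ((Polynomial.X - Polynomial.C (e : ℚ) + 1) *
      (Polynomial.X - Polynomial.C (e : ℚ) + 2)) +
    Polynomial.C (a : ℚ) + Polynomial.C (τ : ℚ) * (Polynomial.X - Polynomial.C (K : ℚ))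

theorem isJacobianHilbertPolynomial_coneEquation {g : MvPolynomial (Fin 3) ℂ} {e K τ : ℕ}
    (hg : g.IsHomogeneous e) (hg0 : g ≠ 0) (he : e ≠ 0) (heK : e ≤ K)
    (hτ : ∀ k, K ≤ k → hilbertFunction (jacobianIdeal g) k = τ) :
    IsJacobianHilbertPolynomial (coneEquation g) (coneHilbertPolynomial e K τ
      (∑ j ∈ Finset.range K, hilbertFunction (jacobianIdeal g) j)) := by
  refine ⟨K, fun k hk => ?_⟩
  rw [jacobianHilbertFunction_eq, hilbertFunction_coneEquation (mem_jacobianIdeal_self hg he)]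
  have h1 := hilbertFunction_add_finrank_idealPiece (Ideal.span {g}) k
  rw [finrank_idealPiece_span_singleton hg hg0 (heK.trans hk)] at h1
  have h2 := two_mul_finrank_homogeneousSubmodule k
  have h3 := two_mul_finrank_homogeneousSubmodule (k - e)
  obtain ⟨m, rfl⟩ := Nat.exists_eq_add_of_le hk
  have h4 : ∑ j ∈ Finset.range (K + m), hilbertFunction (jacobianIdeal g) j =
      ∑ j ∈ Finset.range K, hilbertFunction (jacobianIdeal g) j + m * τ := by
    rw [Finset.sum_range_add, Finset.sum_congr rfl fun j _ => hτ (K + j) (Nat.le_add_right _ _),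
      Finset.sum_const, Finset.card_range, smul_eq_mul]
  rw [h4]
  have h5 : ((K + m - e : ℕ) : ℚ) = K + m - e := by
    rw [Nat.cast_sub (by omega), Nat.cast_add]
  have h1' := congrArg (Nat.cast : ℕ → ℚ) h1
  have h2' := congrArg (Nat.cast : ℕ → ℚ) h2
  have h3' := congrArg (Nat.cast : ℕ → ℚ) h3
  push_cast at h1' h2' h3'
  rw [h5] at h3'
  simp only [coneHilbertPolynomial, Polynomial.eval_add, Polynomial.eval_sub, Polynomial.eval_mul,
    Polynomial.eval_C, Polynomial.eval_X, Polynomial.eval_one, Polynomial.eval_ofNat]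
  push_cast
  linear_combination h1' + 1 / 2 * h2' - 1 / 2 * h3'

theorem coneHilbertPolynomial_eval_lt {e K τ a a' : ℕ} (h : a' < a) :
    (coneHilbertPolynomial e K τ a').eval 0 < (coneHilbertPolynomial e K τ a).eval 0 := by
  have h' : (a' : ℚ) < a := Nat.cast_lt.2 h
  simp only [coneHilbertPolynomial, Polynomial.eval_add, Polynomial.eval_sub, Polynomial.eval_mul,
    Polynomial.eval_C, Polynomial.eval_X]
  linarith

theorem IsReducedFamily.isHomogeneous_equation {n e : ℕ} {ℓ : Fin e → MvPolynomial (Fin n) ℂ}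
    (h : IsReducedFamily ℓ) (c : ℂ) : (C c * formProduct ℓ Finset.univ).IsHomogeneous e := by
  have := (h.isHomogeneous_formProduct Finset.univ).C_mul c
  rwa [Finset.card_univ, Fintype.card_fin] at this

theorem IsReducedFamily.equation_ne_zero {n e : ℕ} {ℓ : Fin e → MvPolynomial (Fin n) ℂ}
    (h : IsReducedFamily ℓ) {c : ℂ} (hc : c ≠ 0) : C c * formProduct ℓ Finset.univ ≠ 0 :=
  mul_ne_zero (by simpa using hc) (Finset.prod_ne_zero_iff.2 fun i _ => (h.1 i).2)

/-- With no hyperplane the Jacobian ideal is zero, and with one hyperplane it is the whole ring. -/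
theorem jacobianIdeal_eq_of_le_one {n e : ℕ} (he : e ≤ 1) {ℓ ℓ' : Fin e → MvPolynomial (Fin n) ℂ}
    (h : IsReducedFamily ℓ) (h' : IsReducedFamily ℓ') :
    jacobianIdeal (formProduct ℓ Finset.univ) = jacobianIdeal (formProduct ℓ' Finset.univ) := by
  have htop : ∀ {p : MvPolynomial (Fin n) ℂ}, p.IsHomogeneous 1 → p ≠ 0 → jacobianIdeal p = ⊤ := by
    intro p hp hp0
    obtain ⟨i, hi⟩ := exists_pderiv_ne_zero hp hp0
    refine Ideal.eq_top_of_isUnit_mem _ (pderiv_mem_jacobianIdeal p i) ?_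
    rw [pderiv_linear hp i]
    exact (isUnit_iff_ne_zero.2 hi).map C
  interval_cases e
  · simp [formProduct]
  · simp only [formProduct, Fin.prod_univ_one]
    rw [htop (h.1 0).1 (h.1 0).2, htop (h'.1 0).1 (h'.1 0).2]

theorem theorem1p3 (g g' : MvPolynomial (Fin 3) ℂ)
    (hg : IsArrangementEquation g) (hg' : IsArrangementEquation g') :
    (SameLattice g g' → SameLattice (coneEquation g) (coneEquation g')) ∧
    (IsZieglerPair g g' → ConditionSPEC g g' → ¬ ConditionHF g g' →
      ∃ P P' : Polynomial ℚ,
        IsJacobianHilbertPolynomial (coneEquation g) P ∧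
        IsJacobianHilbertPolynomial (coneEquation g') P' ∧
        P ≠ P' ∧ P'.eval 0 < P.eval 0) := by
  refine ⟨SameLattice.coneEquation hg hg', ?_⟩
  rintro ⟨-, -, hL, -⟩ ⟨t₀, F, ht₀, hsmooth, hF0, hFt₀, harr, hlat, β, hβ⟩ hHF
  obtain ⟨e, ℓ, c, hc, h, hgℓ⟩ := hg.exists_family
  obtain ⟨e', ℓ', c', hc', h', hgℓ'⟩ := hg'.exists_family
  have h0mem : (0 : ℝ) ∈ Set.Icc 0 t₀ := ⟨le_rfl, ht₀.le⟩
  -- The lattice determines the degree, so that all members of the family have degree `e`.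
  have hhom : ∀ t ∈ Set.Icc 0 t₀, (F t).IsHomogeneous e := by
    intro t ht
    obtain ⟨et, ℓt, ct, hct, hℓt, hFt⟩ := (harr t ht).exists_family
    have hlt := hlat 0 h0mem t ht
    rw [hF0, hgℓ, hFt] at hlt
    obtain ⟨σ, -⟩ := exists_equiv_of_sameLattice h hℓt hc hct hlt
    have hcard := Fintype.card_congr σ
    rw [Fintype.card_fin, Fintype.card_fin] at hcard
    rw [hFt, hcard]
    exact hℓt.isHomogeneous_equation ct
  have hle : ∀ k, hilbertFunction (jacobianIdeal g') k ≤ hilbertFunction (jacobianIdeal g) k := by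
    intro k
    obtain ⟨t, ht, hlt⟩ := exists_hilbertFunction_le ht₀ (fun m => (hsmooth m).continuousOn) hhom k
    have ht₀mem : t₀ ∈ Set.Ioc 0 t₀ := ⟨ht₀, le_rfl⟩
    rw [hilbertFunction_eq_of_isJacobianBetti (hhom t (Set.Ioc_subset_Icc_self ht))
      (hhom t₀ (Set.Ioc_subset_Icc_self ht₀mem)) (hβ t ht) (hβ t₀ ht₀mem), hF0, hFt₀] at hlt
    exact hlt
  obtain ⟨k₀, hk₀⟩ := not_forall.1 hHF
  have hlt : hilbertFunction (jacobianIdeal g') k₀ < hilbertFunction (jacobianIdeal g) k₀ :=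
    lt_of_le_of_ne (hle k₀) (Ne.symm hk₀)
  subst hgℓ hgℓ'
  obtain ⟨σ, hσ⟩ := exists_equiv_of_sameLattice h h' hc hc' hL
  obtain rfl : e = e' := by simpa using Fintype.card_congr σ
  rw [jacobianIdeal_C_mul hc, jacobianIdeal_C_mul hc'] at hlt
  have he : 2 ≤ e := by
    by_contra! he
    rw [jacobianIdeal_eq_of_le_one (by omega) h h'] at hlt
    exact lt_irrefl _ hlt
  have hnt : Nontrivial (Fin e) := Fin.nontrivial_iff_two_le.2 he
  obtain ⟨M, hM⟩ := h.exists_hilbertFunction_eq_tjurinaNumber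
  obtain ⟨M', hM'⟩ := h'.exists_hilbertFunction_eq_tjurinaNumber
  rw [← tjurinaNumber_eq_of_equiv h h' σ hσ] at hM'
  have hk₀M : k₀ < max M M' := by
    by_contra! hk
    rw [hM k₀ (le_of_max_le_left hk), hM' k₀ (le_of_max_le_right hk)] at hlt
    exact lt_irrefl _ hlt
  have hP := isJacobianHilbertPolynomial_coneEquation (K := max M M' + e) (τ := tjurinaNumber ℓ)
    (h.isHomogeneous_equation c) (h.equation_ne_zero hc) (by omega) (by omega) fun k hk => by
      rw [jacobianIdeal_C_mul hc]; exact hM k (by omega)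
  have hP' := isJacobianHilbertPolynomial_coneEquation (K := max M M' + e) (τ := tjurinaNumber ℓ)
    (h'.isHomogeneous_equation c') (h'.equation_ne_zero hc') (by omega) (by omega) fun k hk => by
      rw [jacobianIdeal_C_mul hc']; exact hM' k (by omega)
  have hlt0 := coneHilbertPolynomial_eval_lt (e := e) (K := max M M' + e) (τ := tjurinaNumber ℓ)
    (Finset.sum_lt_sum (s := Finset.range (max M M' + e)) (fun k _ => hle k)
      ⟨k₀, Finset.mem_range.2 (by omega), by
        rwa [jacobianIdeal_C_mul hc, jacobianIdeal_C_mul hc']⟩)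
  exact ⟨_, _, hP, hP', fun heq => hlt0.ne (congrArg (Polynomial.eval 0) heq).symm, hlt0⟩
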